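/- **Language.** FPC is the call-by-name simply typed $\lambda$-calculus with types $\tau ::= \alpha \mid 1 \mid \tau\times\tau \mid \tau+\tau \mid \tau\to\tau \mid \mu\alpha.\tau$ and terms $\langle\rangle$, $x$, $\mathrm{inl}\,M$, $\mathrm{inr}\,M$, $\mathrm{case}\,L\,\mathrm{of}\,x_1.M;x_2.N$, $\langle M,N\rangle$, $\mathrm{fst}\,M$, $\mathrm{snd}\,M$, $\lambda x{:}\tau.M$, $M\,N$, $\mathrm{fold}\,M$, $\mathrm{unfold}\,M$, with the usual typing rules. The big-step semantics $M\Downarrow^k v$, for closed terms $M$, values $v$ ($\langle\rangle$, $\mathrm{inl}\,M$, $\mathrm{inr}\,M$, $\langle M,N\rangle$, $\lambda x{:}\tau.M$, $\mathrm{fold}\,M$) and $k\in\mathbb N$, counts unfold-fold reductions: $v\Downarrow^0 v$; if $M\Downarrow^k\mathrm{fold}\,N$ and $N\Downarrow^m v$ then $\mathrm{unfold}\,M\Downarrow^{k+m+1}v$; in the usual rules for case, projections and application the step counts of the premises are added. **Semantics.** Guarded dependent type theory is interpreted in the topos of trees (presheaves on $\omega$), with $\triangleright X(1)=1$, $\triangleright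 X(n+1)=X(n)$, with $\mathrm{next}:X\to\triangleright X$ given by restriction, and with $\forall\kappa.X$ the set of global elements of $X$. Let $LA$ be the guarded recursive type $LA\cong A+\triangleright LA$, with $\eta:A\to LA$ and $\theta:\triangleright LA\to LA$. Put $[\![1]\!]=L1$, $[\![\sigma+\tau]\!]=L([\![\sigma]\!]+[\![\tau]\!])$, $[\![\sigma\times\tau]\!]=[\![\sigma]\!]\times[\![\tau]\!]$, $[\![\sigma\to\tau]\!]=[\![\sigma]\!]\to[\![\tau]\!]$, and let $[\![\mu\alpha.\tau]\!](\rho)$ be the unique solution $X$ of $X=\triangleright[\![\tau]\!](\rho,X)$; for closed $\mu\alpha.\tau$ this equals $\triangleright[\![\tau[\mu\alpha.\tau/\alpha]]\!]$. Every closed type carries a map $\theta_\sigma:\triangleright[\![\sigma]\!]\to[\![\sigma]\!]$, defined by guarded recursion and induction on $\sigma$: it is $\theta$ for $1$ and for sums, is componentwise for products, is pointwise for functions, and is $\triangleright\theta_{\tau[\mu\alpha.\tau/\alpha]}$ for $\mu\alpha.\tau$. A judgement $\Gamma\vdash M:\tau$ denotes a morphism $[\![\Gamma]\!]\to[\![\tau]\!]$: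 products and functions are interpreted in the standard way; $\langle\rangle$, $\mathrm{inl}$ and $\mathrm{inr}$ by $\eta(*)$, $\eta\circ\mathrm{inl}$ and $\eta\circ\mathrm{inr}$; $\mathrm{case}$ by the extension $\hat f$ of the copairing $f$ of the branches ($\hat f(\eta(a))=f(a)$, $\hat f(\theta(r))=\theta_\tau(\triangleright\hat f(r))$); $\mathrm{fold}$ by $\mathrm{next}$; and $\mathrm{unfold}$ at $\mu\alpha.\tau$ by $\theta_{\tau[\mu\alpha.\tau/\alpha]}$. For closed $M:\tau$ let $[\![M]\!]^{\mathrm{gl}}\in\forall\kappa.[\![\tau]\!]$ be the corresponding global element. **Execution.** Define $\mathrm{runstep}:\forall\kappa.L(L1+L1)\to(1+1)+\forall\kappa.L(L1+L1)$ as follows. If $x$ is everywhere of the form $\eta(\mathrm{inl}(y))$, then $\mathrm{runstep}\,x=\mathrm{inl}(\mathrm{inl}(\star))$; if it is everywhere of the form $\eta(\mathrm{inr}(y))$, then $\mathrm{runstep}\,x=\mathrm{inl}(\mathrm{inr}(\star))$; otherwise $x=\theta(z)$ for a global element $z$ of $\triangleright L(L1+L1)$, and $\mathrm{runstep}\,x=\mathrm{inr}(z')$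 with $z'\in\forall\kappa.L(L1+L1)$ corresponding to $z$ under $\forall\kappa.\triangleright A\cong\forall\kappa.A$. Put $\mathrm{exec}\,0\,x=\mathrm{runstep}\,x$; let $\mathrm{exec}\,(n+1)\,x=\mathrm{runstep}\,x$ if $\mathrm{runstep}\,x$ is in the left summand, and $\mathrm{exec}\,(n+1)\,x=\mathrm{exec}\,n\,y$ if $\mathrm{runstep}\,x=\mathrm{inr}(y)$. **Proposition.** Let $M$ be a closed term of FPC of type $1+1$ and let $n\in\mathbb N$. Then $$\mathrm{exec}\,n\,[\![M]\!]^{\mathrm{gl}}=\mathrm{inl}(\mathrm{inl}(\star))$$ if and only if there exist a term $N$ and a number $k\le n$ such that $M\Downarrow^k\mathrm{inl}(N)$. -/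

import Mathlib

namespace FPC

/-! ### The topos of trees: presheaves over the first infinite ordinal -/

/-- An object of the topos of trees: a family of sets indexed by the natural numbers with
restriction maps. Stages are numbered from `0`. -/
@[ext]
structure Obj where
  T : ℕ → Type
  r : ∀ n, T (n + 1) → T n

/-- Morphisms of the topos of trees: natural families of functions. -/
@[ext]
structure Hom (X Y : Obj) where
  app : ∀ n, X.T n → Y.T n
  nat : ∀ n x, Y.r n (app (n + 1) x) = app n (X.r n x)

/-- Global elements. This is the interpretation of universal quantification over the
(unique, implicit) clock: an element of `Glob X` is an element of `∀ κ. X`. -/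
@[ext]
structure Glob (X : Obj) where
  val : ∀ n, X.T n
  compat : ∀ n, X.r n (val (n + 1)) = val n

namespace Obj

/-- Restriction from stage `n` to an earlier stage `j`. -/
def res (X : Obj) {j n : ℕ} (h : j ≤ n) (x : X.T n) : X.T j :=
  Nat.decreasingInduction (motive := fun m _ => X.T m) (fun k _ => X.r k) x h

theorem res_self (X : Obj) {n : ℕ} (h : n ≤ n) (x : X.T n) : X.res h x = x :=
  Nat.decreasingInduction_self _ _

theorem res_r (X : Obj) {j n : ℕ} (h : j + 1 ≤ n) (x : X.T n) :
    X.r j (X.res h x) = X.res (Nat.le_of_succ_le h) x :=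
  (Nat.decreasingInduction_succ_left (motive := fun m _ => X.T m) _ _ _ _).symm

theorem res_succ (X : Obj) {j n : ℕ} (h : j ≤ n) (x : X.T (n + 1)) :
    X.res h (X.r n x) = X.res (Nat.le_succ_of_le h) x := by
  induction h using Nat.decreasingInduction with
  | self => rw [res_self, ← res_r X (Nat.le_refl (n + 1)), res_self]
  | of_succ k hk ih => rw [← res_r X hk, ih, res_r]

/-- The terminal object. -/
abbrev one : Obj := ⟨fun _ => PUnit, fun _ x => x⟩

/-- Binary products. -/
abbrev prod (X Y : Obj) : Obj := ⟨fun n => X.T n × Y.T n, fun n => Prod.map (X.r n) (Y.r n)⟩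

/-- Binary sums. -/
abbrev sum (X Y : Obj) : Obj := ⟨fun n => X.T n ⊕ Y.T n, fun n => Sum.map (X.r n) (Y.r n)⟩

/-- Products indexed by a (constant) type. -/
abbrev pi {ι : Type} (F : ι → Obj) : Obj := ⟨fun n => ∀ i, (F i).T n, fun n x i => (F i).r n (x i)⟩

/-- Function types: at stage `n`, families of functions at all stages up to `n` which commute
with restrictions. -/
abbrev exp (X Y : Obj) : Obj where
  T n := {f : ∀ j, j ≤ n → X.T j → Y.T j //
    ∀ j (h : j + 1 ≤ n) x, Y.r j (f (j + 1) h x) = f j (Nat.le_of_succ_le h) (X.r j x)}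
  r _ f := ⟨fun j h => f.1 j (Nat.le_succ_of_le h), fun j h x => f.2 j (Nat.le_succ_of_le h) x⟩

/-- The sets of the object `▷ X`. -/
def laterT (X : Obj) : ℕ → Type
  | 0 => PUnit
  | n + 1 => X.T n

def laterR (X : Obj) : ∀ n, laterT X (n + 1) → laterT X n
  | 0 => fun _ => PUnit.unit
  | n + 1 => X.r n

/-- The `later` modality `▷`. -/
def later (X : Obj) : Obj := ⟨laterT X, laterR X⟩

def liftT (A : Obj) : ℕ → Type
  | 0 => A.T 0 ⊕ PUnit
  | n + 1 => A.T (n + 1) ⊕ liftT A n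

def liftR (A : Obj) : ∀ n, liftT A (n + 1) → liftT A n
  | 0 => Sum.map (A.r 0) (fun _ => PUnit.unit)
  | n + 1 => Sum.map (A.r (n + 1)) (liftR A n)

/-- The guarded lifting monad `L`. -/
def lift (A : Obj) : Obj := ⟨liftT A, liftR A⟩

/-- `L A` solves the guarded recursive type equation `L A = A + ▷ L A`. -/
theorem lift_eq (A : Obj) : lift A = sum A (later (lift A)) := by
  have hT : liftT A = fun n => A.T n ⊕ laterT (lift A) n := by
    funext n; cases n <;> rfl
  refine Obj.ext hT ?_
  refine Function.hfunext rfl ?_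
  rintro n _ ⟨⟩
  cases n <;> exact HEq.rfl

/-! ### Guarded recursive types -/

/-- `X` and `Y` agree at all stages before `n`. -/
def Agree (n : ℕ) (X Y : Obj) : Prop :=
  (∀ i, i < n → X.T i = Y.T i) ∧ ∀ i, i + 1 < n → HEq (X.r i) (Y.r i)

/-- The solution of the type equation `X = F X`. For contractive `F` it exists and is unique,
see `gfix_eq` and `gfix_unique`. -/
noncomputable def gfix (F : Obj → Obj) : Obj :=
  @Classical.epsilon Obj ⟨one⟩ fun X => X = F X

/-- `F` maps objects that agree before stage `n` to objects that agree before stage `n + 1`. -/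
def Contractive (F : Obj → Obj) : Prop :=
  ∀ n X Y, Agree n X Y → Agree (n + 1) (F X) (F Y)

theorem Agree.refl (n : ℕ) (X : Obj) : Agree n X X := ⟨fun _ _ => rfl, fun _ _ => HEq.rfl⟩

theorem Agree.symm {n : ℕ} {X Y : Obj} (h : Agree n X Y) : Agree n Y X :=
  ⟨fun i hi => (h.1 i hi).symm, fun i hi => (h.2 i hi).symm⟩

theorem Agree.trans {n : ℕ} {X Y Z : Obj} (h : Agree n X Y) (h' : Agree n Y Z) : Agree n X Z :=
  ⟨fun i hi => (h.1 i hi).trans (h'.1 i hi), fun i hi => (h.2 i hi).trans (h'.2 i hi)⟩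

theorem Agree.mono {m n : ℕ} {X Y : Obj} (hmn : m ≤ n) (h : Agree n X Y) : Agree m X Y :=
  ⟨fun i hi => h.1 i (by omega), fun i hi => h.2 i (by omega)⟩

theorem Agree.zero (X Y : Obj) : Agree 0 X Y :=
  ⟨fun i hi => absurd hi (by omega), fun i hi => absurd hi (by omega)⟩

theorem eq_of_agree {X Y : Obj} (h : ∀ n, Agree n X Y) : X = Y := by
  refine Obj.ext (funext fun i => (h (i + 1)).1 i (by omega)) ?_
  refine Function.hfunext rfl ?_
  rintro n _ ⟨⟩
  exact (h (n + 2)).2 n (by omega)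

theorem exists_fix {F : Obj → Obj} (hF : Contractive F) : ∃ X, X = F X := by
  let S : ℕ → Obj := fun k => F^[k] one
  have hS : ∀ k, S (k + 1) = F (S k) := fun k => Function.iterate_succ_apply' F k one
  have h1 : ∀ k, Agree k (S k) (S (k + 1)) := by
    intro k
    induction k with
    | zero => exact Agree.zero _ _
    | succ k ih =>
      rw [hS k, hS (k + 1)]
      exact hF _ _ _ ih
  have h2 : ∀ k d, Agree k (S k) (S (k + d)) := by
    intro k d
    induction d with
    | zero => exact Agree.refl _ _
    | succ d ih => exact ih.trans ((h1 (k + d)).mono (by omega))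
  have h3 : ∀ k m, k ≤ m → Agree k (S k) (S m) := by
    intro k m h
    obtain ⟨d, rfl⟩ := Nat.exists_eq_add_of_le h
    exact h2 k d
  have e : ∀ n, (S (n + 2)).T n = (S (n + 1)).T n := fun n =>
    ((h1 (n + 1)).1 n (by omega)).symm
  let Z : Obj := ⟨fun n => (S (n + 1)).T n, fun n x => cast (e n) ((S (n + 2)).r n x)⟩
  have aux : ∀ {α β γ : Type} (h : β = γ) (f : α → β), HEq (fun x => cast h (f x)) f := by
    rintro α β γ rfl f
    exact HEq.rfl
  have hZ : ∀ k, Agree k Z (S k) := by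
    intro k
    refine ⟨fun i hi => (h3 (i + 1) k hi).1 i (by omega), fun i hi => ?_⟩
    exact (aux (e i) ((S (i + 2)).r i)).trans ((h3 (i + 2) k hi).2 i (by omega))
  refine ⟨Z, eq_of_agree fun n => ?_⟩
  have h4 := hF _ _ _ (hZ n)
  rw [← hS] at h4
  exact ((hZ (n + 1)).trans h4.symm).mono (by omega)

/-- Guarded recursive type equations have solutions. -/
theorem gfix_eq {F : Obj → Obj} (hF : Contractive F) : gfix F = F (gfix F) :=
  Classical.epsilon_spec (p := fun X => X = F X) (exists_fix hF)

/-- Guarded recursive type equations have at most one solution. -/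
theorem gfix_unique {F : Obj → Obj} (hF : Contractive F) {X : Obj} (hX : X = F X) :
    X = gfix F := by
  refine eq_of_agree fun n => ?_
  induction n with
  | zero => exact Agree.zero _ _
  | succ n ih =>
    rw [hX, gfix_eq hF]
    exact hF _ _ _ ih

theorem heq_fun {α α' β β' : Type} {f : α → β} {f' : α' → β'} (hα : α = α') (hβ : β = β')
    (h : ∀ x x', HEq x x' → HEq (f x) (f' x')) : HEq f f' := by
  subst hα hβ
  exact heq_of_eq (funext fun x => eq_of_heq (h x x HEq.rfl))

theorem Agree.later {n : ℕ} {X Y : Obj} (h : Agree n X Y) :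
    Agree (n + 1) (Obj.later X) (Obj.later Y) := by
  have hT : ∀ i, i < n + 1 → (Obj.later X).T i = (Obj.later Y).T i := by
    rintro (_ | i) hi
    · rfl
    · exact h.1 i (by omega)
  refine ⟨hT, ?_⟩
  rintro (_ | i) hi
  · exact heq_fun (hT 1 hi) rfl fun _ _ _ => HEq.rfl
  · exact h.2 i (by omega)

theorem sum_map_heq {α α' β β' γ γ' δ δ' : Type} {f : α → β} {f' : α' → β'} {g : γ → δ}
    {g' : γ' → δ'} (h1 : α = α') (h2 : β = β') (h3 : γ = γ') (h4 : δ = δ') (hf : HEq f f')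
    (hg : HEq g g') : HEq (Sum.map f g) (Sum.map f' g') := by
  subst h1 h2 h3 h4
  cases hf
  cases hg
  rfl

theorem prod_map_heq {α α' β β' γ γ' δ δ' : Type} {f : α → β} {f' : α' → β'} {g : γ → δ}
    {g' : γ' → δ'} (h1 : α = α') (h2 : β = β') (h3 : γ = γ') (h4 : δ = δ') (hf : HEq f f')
    (hg : HEq g g') : HEq (Prod.map f g) (Prod.map f' g') := by
  subst h1 h2 h3 h4
  cases hf
  cases hg
  rfl

theorem Agree.prod {n : ℕ} {X X' Y Y' : Obj} (h : Agree n X X') (h' : Agree n Y Y') :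
    Agree n (prod X Y) (prod X' Y') :=
  ⟨fun i hi => congrArg₂ Prod (h.1 i hi) (h'.1 i hi), fun i hi =>
    prod_map_heq (h.1 _ hi) (h.1 _ (by omega)) (h'.1 _ hi) (h'.1 _ (by omega)) (h.2 i hi)
      (h'.2 i hi)⟩

theorem Agree.sum {n : ℕ} {X X' Y Y' : Obj} (h : Agree n X X') (h' : Agree n Y Y') :
    Agree n (sum X Y) (sum X' Y') :=
  ⟨fun i hi => congrArg₂ Sum (h.1 i hi) (h'.1 i hi), fun i hi =>
    sum_map_heq (h.1 _ hi) (h.1 _ (by omega)) (h'.1 _ hi) (h'.1 _ (by omega)) (h.2 i hi)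
      (h'.2 i hi)⟩

theorem Agree.lift {n : ℕ} {X Y : Obj} (h : Agree n X Y) : Agree n (lift X) (lift Y) := by
  induction n with
  | zero => exact Agree.zero _ _
  | succ n ih =>
    rw [lift_eq X, lift_eq Y]
    exact h.sum (Agree.later (ih (h.mono (by omega))))

/-- The data of an object up to stage `n`. -/
structure Pre (n : ℕ) where
  T : ∀ j, j ≤ n → Type
  r : ∀ j (h : j + 1 ≤ n), T (j + 1) h → T j (Nat.le_of_succ_le h)

def toPre (X : Obj) (n : ℕ) : Pre n := ⟨fun j _ => X.T j, fun j _ => X.r j⟩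

def Pre.cut {n : ℕ} (P : Pre (n + 1)) : Pre n :=
  ⟨fun j h => P.T j (Nat.le_succ_of_le h), fun j h => P.r j (Nat.le_succ_of_le h)⟩

theorem Agree.toPre {n : ℕ} {X Y : Obj} (h : Agree n X Y) {i : ℕ} (hi : i < n) :
    toPre X i = toPre Y i := by
  have hT : (fun j (_ : j ≤ i) => X.T j) = fun j (_ : j ≤ i) => Y.T j := by
    funext j hj
    exact h.1 j (by omega)
  have hr : HEq (fun j (_ : j + 1 ≤ i) => X.r j) (fun j (_ : j + 1 ≤ i) => Y.r j) := by
    refine Function.hfunext rfl ?_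
    rintro j _ ⟨⟩
    refine Function.hfunext rfl ?_
    rintro hj _ ⟨⟩
    exact h.2 j (by omega)
  unfold Obj.toPre
  congr

def Pre.exp {n : ℕ} (P Q : Pre n) : Type :=
  {f : ∀ j h, P.T j h → Q.T j h //
    ∀ j (h : j + 1 ≤ n) x, Q.r j h (f (j + 1) h x) = f j (Nat.le_of_succ_le h) (P.r j h x)}

def Pre.expR {n : ℕ} (P Q : Pre (n + 1)) (f : P.exp Q) : P.cut.exp Q.cut :=
  ⟨fun j h => f.1 j (Nat.le_succ_of_le h), fun j h x => f.2 j (Nat.le_succ_of_le h) x⟩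

theorem Agree.exp {n : ℕ} {X X' Y Y' : Obj} (h : Agree n X X') (h' : Agree n Y Y') :
    Agree n (exp X Y) (exp X' Y') := by
  refine ⟨fun i hi => ?_, fun i hi => ?_⟩
  · change (Obj.toPre X i).exp (Obj.toPre Y i) = (Obj.toPre X' i).exp (Obj.toPre Y' i)
    rw [h.toPre hi, h'.toPre hi]
  · change HEq (Pre.expR (Obj.toPre X (i + 1)) (Obj.toPre Y (i + 1)))
      (Pre.expR (Obj.toPre X' (i + 1)) (Obj.toPre Y' (i + 1)))
    rw [h.toPre hi, h'.toPre hi]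

end Obj

open Obj

/-! ### Morphisms -/

namespace Hom

def id (X : Obj) : Hom X X := ⟨fun _ x => x, fun _ _ => rfl⟩

/-- Composition, in diagrammatic order. -/
def comp {X Y Z : Obj} (f : Hom X Y) (g : Hom Y Z) : Hom X Z :=
  ⟨fun n x => g.app n (f.app n x), fun n x => by rw [g.nat, f.nat]⟩

/-- The morphism between equal objects. -/
def ofEq {X Y : Obj} (h : X = Y) : Hom X Y :=
  ⟨fun n => cast (congrArg (fun Z : Obj => Z.T n) h), by subst h; exact fun _ _ => rfl⟩

def toOne (X : Obj) : Hom X one := ⟨fun _ _ => PUnit.unit, fun _ _ => rfl⟩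

def pair {X Y Z : Obj} (f : Hom X Y) (g : Hom X Z) : Hom X (prod Y Z) :=
  ⟨fun n x => (f.app n x, g.app n x), fun n x => Prod.ext (f.nat n x) (g.nat n x)⟩

def fst (X Y : Obj) : Hom (prod X Y) X := ⟨fun _ x => x.1, fun _ _ => rfl⟩

def snd (X Y : Obj) : Hom (prod X Y) Y := ⟨fun _ x => x.2, fun _ _ => rfl⟩

def inl (X Y : Obj) : Hom X (sum X Y) := ⟨fun _ x => Sum.inl x, fun _ _ => rfl⟩

def inr (X Y : Obj) : Hom Y (sum X Y) := ⟨fun _ x => Sum.inr x, fun _ _ => rfl⟩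

/-- Definition by cases, with a parameter of type `C`. -/
def cases {C X Y Z : Obj} (f : Hom (prod C X) Z) (g : Hom (prod C Y) Z) :
    Hom (prod C (sum X Y)) Z where
  app n
    | (c, .inl x) => f.app n (c, x)
    | (c, .inr y) => g.app n (c, y)
  nat n := by
    rintro ⟨c, x | y⟩
    · exact f.nat n (c, x)
    · exact g.nat n (c, y)

def proj {ι : Type} (F : ι → Obj) (i : ι) : Hom (pi F) (F i) := ⟨fun _ x => x i, fun _ _ => rfl⟩

def tuple {ι : Type} {X : Obj} {F : ι → Obj} (f : ∀ i, Hom X (F i)) : Hom X (pi F) :=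
  ⟨fun n x i => (f i).app n x, fun n x => funext fun i => (f i).nat n x⟩

def eval (X Y : Obj) : Hom (prod (exp X Y) X) Y :=
  ⟨fun n x => x.1.1 n le_rfl x.2, fun n x => x.1.2 n le_rfl x.2⟩

def curry {C X Y : Obj} (f : Hom (prod C X) Y) : Hom C (exp X Y) where
  app n c := ⟨fun j h x => f.app j (C.res h c, x), fun j h x => by
    exact (f.nat j (C.res h c, x)).trans
      (congrArg (fun c' => f.app j (c', X.r j x)) (C.res_r h c))⟩
  nat n c := Subtype.ext <| funext fun j => funext fun h => funext fun x => by
    change f.app j (C.res _ c, x) = f.app j (C.res h (C.r n c), x)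
    rw [C.res_succ h]

def nextApp (X : Obj) : ∀ n, X.T n → (later X).T n
  | 0 => fun _ => PUnit.unit
  | n + 1 => X.r n

/-- `next : X → ▷ X`. -/
def next (X : Obj) : Hom X (later X) :=
  ⟨nextApp X, fun n _ => by cases n <;> rfl⟩

def laterMapApp {X Y : Obj} (f : Hom X Y) : ∀ n, (later X).T n → (later Y).T n
  | 0 => fun _ => PUnit.unit
  | n + 1 => f.app n

/-- The action of `▷` on morphisms. -/
def laterMap {X Y : Obj} (f : Hom X Y) : Hom (later X) (later Y) where
  app := laterMapApp f
  nat
    | 0 => fun _ => rfl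
    | n + 1 => f.nat n

def laterPairApp (X Y : Obj) : ∀ n, (prod (later X) (later Y)).T n → (later (prod X Y)).T n
  | 0 => fun _ => PUnit.unit
  | _ + 1 => fun x => x

/-- `▷` preserves products. -/
def laterPair (X Y : Obj) : Hom (prod (later X) (later Y)) (later (prod X Y)) where
  app := laterPairApp X Y
  nat
    | 0 => fun _ => rfl
    | _ + 1 => fun _ => rfl

/-- Later application `▷ (X → Y) × ▷ X → ▷ Y`. -/
def laterApp (X Y : Obj) : Hom (prod (later (exp X Y)) (later X)) (later Y) :=
  (laterPair (exp X Y) X).comp (laterMap (eval X Y))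

/-- Unfolding of the type equation for `L`. -/
def liftUnfold (A : Obj) : Hom (lift A) (sum A (later (lift A))) := ofEq (lift_eq A)

/-- Folding of the type equation for `L`. -/
def liftFold (A : Obj) : Hom (sum A (later (lift A))) (lift A) := ofEq (lift_eq A).symm

/-- The unit `η : A → L A`. -/
def now (A : Obj) : Hom A (lift A) := (inl A (later (lift A))).comp (liftFold A)

/-- The algebra structure `θ : ▷ L A → L A`. -/
def tickL (A : Obj) : Hom (later (lift A)) (lift A) := (inr A (later (lift A))).comp (liftFold A)

def extendApp {C A B : Obj} (θ : Hom (later B) B) (f : Hom (prod C A) B) :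
    ∀ n, (prod C (lift A)).T n → B.T n
  | 0 => fun x => match x with
    | (c, .inl a) => f.app 0 (c, a)
    | (_, .inr _) => θ.app 0 PUnit.unit
  | n + 1 => fun x => match x with
    | (c, .inl a) => f.app (n + 1) (c, a)
    | (c, .inr y) => θ.app (n + 1) (extendApp θ f n (C.r n c, y))

/-- The extension of `f` to a homomorphism of `▷`-algebras on `L A` (with a parameter of
type `C`): `extend θ f (η a) = f a` and `extend θ f (θ r) = θ (next (extend θ f) ⊛ r)`. -/
def extend {C A B : Obj} (θ : Hom (later B) B) (f : Hom (prod C A) B) :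
    Hom (prod C (lift A)) B where
  app := extendApp θ f
  nat n := by
    induction n with
    | zero =>
      rintro ⟨c, a | y⟩
      · exact f.nat 0 (c, a)
      · exact θ.nat 0 _
    | succ n ih =>
      rintro ⟨c, a | y⟩
      · exact f.nat (n + 1) (c, a)
      · exact (θ.nat (n + 1) _).trans (congrArg (θ.app (n + 1)) (ih (C.r (n + 1) c, y)))

end Hom

namespace Glob

/-- The action of `∀ κ` on morphisms. -/
def map {X Y : Obj} (f : Hom X Y) (x : Glob X) : Glob Y :=
  ⟨fun n => f.app n (x.val n), fun n => by rw [f.nat, x.compat]⟩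

def fixVal {X : Obj} (f : Hom (later X) X) : ∀ n, X.T n
  | 0 => f.app 0 PUnit.unit
  | n + 1 => f.app (n + 1) (fixVal f n)

/-- The guarded fixed point combinator. -/
def fix {X : Obj} (f : Hom (later X) X) : Glob X where
  val := fixVal f
  compat n := by
    induction n with
    | zero => exact f.nat 0 _
    | succ n ih => exact (f.nat (n + 1) _).trans (congrArg (f.app (n + 1)) ih)

theorem isLeft_iff {X Y : Obj} (x : Glob (sum X Y)) (n : ℕ) :
    (x.val n).isLeft = (x.val 0).isLeft := by
  induction n with
  | zero => rfl
  | succ n ih =>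
    rw [← ih, ← x.compat n]
    exact (Sum.isLeft_map _ _ _).symm

theorem isRight_of {X Y : Obj} (x : Glob (sum X Y)) (h : ¬ (x.val 0).isLeft = true) (n : ℕ) :
    (x.val n).isRight = true := by
  rw [← x.isLeft_iff n] at h
  exact (Sum.not_isLeft).1 h

theorem getLeft_compat {α β γ δ : Type} (f : α → γ) (g : β → δ) (a : α ⊕ β) (b : γ ⊕ δ)
    (h : Sum.map f g a = b) (ha : a.isLeft = true) (hb : b.isLeft = true) :
    f (a.getLeft ha) = b.getLeft hb := by
  subst h
  rcases a with a | a
  · rfl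
  · cases ha

theorem getRight_compat {α β γ δ : Type} (f : α → γ) (g : β → δ) (a : α ⊕ β) (b : γ ⊕ δ)
    (h : Sum.map f g a = b) (ha : a.isRight = true) (hb : b.isRight = true) :
    g (a.getRight ha) = b.getRight hb := by
  subst h
  rcases a with a | a
  · cases ha
  · rfl

/-- The isomorphism `∀ κ. (X + Y) ≅ (∀ κ. X) + (∀ κ. Y)`, from left to right: a global element of
a sum lies in the same summand at all stages, which is read off at the first stage. -/
def distrib {X Y : Obj} (x : Glob (sum X Y)) : Glob X ⊕ Glob Y :=
  if h : (x.val 0).isLeft = true then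
    .inl ⟨fun n => (x.val n).getLeft ((x.isLeft_iff n).trans h), fun n =>
      getLeft_compat _ _ _ _ (x.compat n) _ _⟩
  else
    .inr ⟨fun n => (x.val n).getRight (x.isRight_of h n), fun n =>
      getRight_compat _ _ _ _ (x.compat n) _ _⟩

/-- `force : (∀ κ. ▷ X) → ∀ κ. X`. -/
def force {X : Obj} (x : Glob (later X)) : Glob X :=
  ⟨fun n => x.val (n + 1), fun n => x.compat (n + 1)⟩

end Glob

/-! ### Types of FPC and their interpretation -/

/-- Types of FPC with `n` free type variables, as de Bruijn indices. -/
inductive Ty : ℕ → Type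
  | var {n : ℕ} (i : Fin n) : Ty n
  | unit {n : ℕ} : Ty n
  | prod {n : ℕ} (σ τ : Ty n) : Ty n
  | sum {n : ℕ} (σ τ : Ty n) : Ty n
  | arrow {n : ℕ} (σ τ : Ty n) : Ty n
  | mu {n : ℕ} (τ : Ty (n + 1)) : Ty n

namespace Ty

def rename : {n m : ℕ} → (Fin n → Fin m) → Ty n → Ty m
  | _, _, f, var i => var (f i)
  | _, _, _, unit => unit
  | _, _, f, prod σ τ => prod (rename f σ) (rename f τ)
  | _, _, f, sum σ τ => sum (rename f σ) (rename f τ)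
  | _, _, f, arrow σ τ => arrow (rename f σ) (rename f τ)
  | _, _, f, mu τ => mu (rename (Fin.cons 0 fun i => (f i).succ) τ)

/-- Simultaneous capture-avoiding substitution. -/
def subst : {n m : ℕ} → (Fin n → Ty m) → Ty n → Ty m
  | _, _, s, var i => s i
  | _, _, _, unit => unit
  | _, _, s, prod σ τ => prod (subst s σ) (subst s τ)
  | _, _, s, sum σ τ => sum (subst s σ) (subst s τ)
  | _, _, s, arrow σ τ => arrow (subst s σ) (subst s τ)
  | _, _, s, mu τ => mu (subst (Fin.cons (var 0) fun i => (s i).rename Fin.succ) τ)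

/-- `τ[σ/α]`, where `α` is the innermost variable. -/
def inst {n : ℕ} (τ : Ty (n + 1)) (σ : Ty n) : Ty n := τ.subst (Fin.cons σ var)

/-- The interpretation of types. -/
noncomputable def den : {n : ℕ} → Ty n → (Fin n → Obj) → Obj
  | _, var i, ρ => ρ i
  | _, unit, _ => lift one
  | _, prod σ τ, ρ => Obj.prod (den σ ρ) (den τ ρ)
  | _, sum σ τ, ρ => lift (Obj.sum (den σ ρ) (den τ ρ))
  | _, arrow σ τ, ρ => exp (den σ ρ) (den τ ρ)
  | _, mu τ, ρ => gfix fun X => later (den τ (Fin.cons X ρ))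

theorem agree_den {n : ℕ} (τ : Ty n) : ∀ (k : ℕ) (ρ ρ' : Fin n → Obj),
    (∀ i, Agree k (ρ i) (ρ' i)) → Agree k (den τ ρ) (den τ ρ') := by
  induction τ with
  | var i => exact fun k ρ ρ' h => h i
  | unit => exact fun k ρ ρ' _ => Agree.refl _ _
  | prod σ τ ihσ ihτ => exact fun k ρ ρ' h => (ihσ k ρ ρ' h).prod (ihτ k ρ ρ' h)
  | sum σ τ ihσ ihτ => exact fun k ρ ρ' h => ((ihσ k ρ ρ' h).sum (ihτ k ρ ρ' h)).lift
  | arrow σ τ ihσ ihτ => exact fun k ρ ρ' h => (ihσ k ρ ρ' h).exp (ihτ k ρ ρ' h)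
  | mu τ ih =>
    intro k ρ ρ' h
    have step : ∀ (k : ℕ) (ρ ρ' : _ → Obj), (∀ i, Agree k (ρ i) (ρ' i)) → ∀ X Y : Obj,
        Agree k X Y → Agree (k + 1) (later (den τ (Fin.cons X ρ))) (later (den τ (Fin.cons Y ρ')))
        := by
      intro k ρ ρ' h X Y hXY
      refine (ih k _ _ fun i => ?_).later
      refine Fin.cases ?_ (fun i => ?_) i
      · exact hXY
      · exact h i
    have hc : ∀ ρ, Contractive fun X => later (den τ (Fin.cons X ρ)) := fun ρ k X Y hXY =>
      step k ρ ρ (fun i => Agree.refl _ _) X Y hXY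
    induction k with
    | zero => exact Agree.zero _ _
    | succ k ihk =>
      have h' : ∀ i, Agree k (ρ i) (ρ' i) := fun i => (h i).mono (by omega)
      change Agree _ (gfix _) (gfix _)
      rw [gfix_eq (hc ρ), gfix_eq (hc ρ')]
      exact step k ρ ρ' h' _ _ (ihk h')

theorem contractive_den {n : ℕ} (τ : Ty (n + 1)) (ρ : Fin n → Obj) :
    Contractive fun X => later (den τ (Fin.cons X ρ)) := by
  intro k X Y h
  refine (agree_den τ k _ _ fun i => ?_).later
  refine Fin.cases ?_ (fun i => ?_) i
  · exact h
  · exact Agree.refl _ _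

theorem den_rename {n : ℕ} (τ : Ty n) : ∀ {m : ℕ} (f : Fin n → Fin m) (ρ : Fin m → Obj),
    den (τ.rename f) ρ = den τ fun i => ρ (f i) := by
  induction τ with
  | var i => exact fun f ρ => rfl
  | unit => exact fun f ρ => rfl
  | prod σ τ ihσ ihτ => exact fun f ρ => congrArg₂ Obj.prod (ihσ f ρ) (ihτ f ρ)
  | sum σ τ ihσ ihτ =>
    exact fun f ρ => congrArg lift (congrArg₂ Obj.sum (ihσ f ρ) (ihτ f ρ))
  | arrow σ τ ihσ ihτ => exact fun f ρ => congrArg₂ Obj.exp (ihσ f ρ) (ihτ f ρ)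
  | mu τ ih =>
    intro m f ρ
    refine congrArg gfix (funext fun X => congrArg later ?_)
    refine (ih _ _).trans (congrArg (den τ) (funext fun i => ?_))
    refine Fin.cases ?_ (fun i => ?_) i <;> rfl

/-- Substitution lemma for types. -/
theorem den_subst {n : ℕ} (τ : Ty n) : ∀ {m : ℕ} (s : Fin n → Ty m) (ρ : Fin m → Obj),
    den (τ.subst s) ρ = den τ fun i => den (s i) ρ := by
  induction τ with
  | var i => exact fun s ρ => rfl
  | unit => exact fun s ρ => rfl
  | prod σ τ ihσ ihτ => exact fun s ρ => congrArg₂ Obj.prod (ihσ s ρ) (ihτ s ρ)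
  | sum σ τ ihσ ihτ =>
    exact fun s ρ => congrArg lift (congrArg₂ Obj.sum (ihσ s ρ) (ihτ s ρ))
  | arrow σ τ ihσ ihτ => exact fun s ρ => congrArg₂ Obj.exp (ihσ s ρ) (ihτ s ρ)
  | mu τ ih =>
    intro m s ρ
    refine congrArg gfix (funext fun X => congrArg later ?_)
    refine (ih _ _).trans (congrArg (den τ) (funext fun i => ?_))
    refine Fin.cases ?_ (fun i => ?_) i
    · rfl
    · exact den_rename (s i) _ _

/-- The interpretation of a recursive type is `▷` of the interpretation of its unfolding. -/
theorem den_mu {n : ℕ} (τ : Ty (n + 1)) (ρ : Fin n → Obj) :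
    den (mu τ) ρ = later (den (τ.inst (mu τ)) ρ) := by
  refine (gfix_eq (contractive_den τ ρ)).trans (congrArg later ?_)
  refine Eq.trans ?_ (den_subst τ _ ρ).symm
  refine congrArg (den τ) (funext fun i => ?_)
  refine Fin.cases ?_ (fun i => ?_) i <;> rfl

/-- The interpretation of closed types. -/
noncomputable abbrev den₀ (τ : Ty 0) : Obj := den τ Fin.elim0

/-- The type `Π σ. (▷ ⟦σ⟧ → ⟦σ⟧)` of families of `▷`-algebra structures on closed types. -/
noncomputable abbrev AlgObj : Obj := pi fun σ : Ty 0 => exp (later (den₀ σ)) (den₀ σ)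

/-- One step of the definition of the `▷`-algebra structures, by induction on the type; the first
argument is the guarded recursive assumption, used for recursive types. -/
noncomputable def tickStep : (σ : Ty 0) → Hom (Obj.prod (later AlgObj) (later (den₀ σ))) (den₀ σ)
  | unit => (Hom.snd _ _).comp (Hom.tickL one)
  | prod σ τ => Hom.pair
      ((Hom.pair (Hom.fst _ _)
        ((Hom.snd _ _).comp (Hom.laterMap (Hom.fst (den₀ σ) (den₀ τ))))).comp (tickStep σ))
      ((Hom.pair (Hom.fst _ _)
        ((Hom.snd _ _).comp (Hom.laterMap (Hom.snd (den₀ σ) (den₀ τ))))).comp (tickStep τ))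
  | sum σ τ => (Hom.snd _ _).comp (Hom.tickL (Obj.sum (den₀ σ) (den₀ τ)))
  | arrow σ τ => Hom.curry
      ((Hom.pair ((Hom.fst _ _).comp (Hom.fst _ _))
        ((Hom.pair ((Hom.fst _ _).comp (Hom.snd _ _))
          ((Hom.snd _ _).comp (Hom.next (den₀ σ)))).comp
            (Hom.laterApp (den₀ σ) (den₀ τ)))).comp (tickStep τ))
  | mu τ =>
      ((Hom.pair
        ((Hom.fst _ _).comp (Hom.laterMap (Hom.proj _ (τ.inst (mu τ)))))
        ((Hom.snd _ _).comp (Hom.laterMap (Hom.ofEq (den_mu τ _))))).comp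
          (Hom.laterApp (later (den₀ (τ.inst (mu τ)))) (den₀ (τ.inst (mu τ))))).comp
            (Hom.ofEq (den_mu τ _).symm)

/-- The family of all `▷`-algebra structures, as a guarded fixed point. -/
noncomputable def tickAll : Glob AlgObj :=
  Glob.fix (Hom.tuple fun σ => Hom.curry (tickStep σ))

/-- The `▷`-algebra structure `θ : ▷ ⟦σ⟧ → ⟦σ⟧` of a closed type. -/
noncomputable def tick (σ : Ty 0) : Hom (later (den₀ σ)) (den₀ σ) where
  app n x := (tickAll.val n σ).1 n le_rfl x
  nat n x := by
    rw [← tickAll.compat n]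
    exact (tickAll.val (n + 1) σ).2 n le_rfl x

end Ty

/-! ### Terms of FPC -/

/-- Terms of FPC with `n` free variables, as de Bruijn indices. In `case L M N` each of `M` and `N`
binds a variable. -/
inductive Tm : ℕ → Type
  | var {n : ℕ} (i : Fin n) : Tm n
  | unit {n : ℕ} : Tm n
  | inl {n : ℕ} (M : Tm n) : Tm n
  | inr {n : ℕ} (M : Tm n) : Tm n
  | case {n : ℕ} (L : Tm n) (M N : Tm (n + 1)) : Tm n
  | pair {n : ℕ} (M N : Tm n) : Tm n
  | fst {n : ℕ} (M : Tm n) : Tm n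
  | snd {n : ℕ} (M : Tm n) : Tm n
  | lam {n : ℕ} (σ : Ty 0) (M : Tm (n + 1)) : Tm n
  | app {n : ℕ} (M N : Tm n) : Tm n
  | fold {n : ℕ} (M : Tm n) : Tm n
  | unfold {n : ℕ} (M : Tm n) : Tm n

namespace Tm

def rename : {n m : ℕ} → (Fin n → Fin m) → Tm n → Tm m
  | _, _, f, var i => var (f i)
  | _, _, _, unit => unit
  | _, _, f, inl M => inl (rename f M)
  | _, _, f, inr M => inr (rename f M)
  | _, _, f, case L M N => case (rename f L) (rename (Fin.cons 0 fun i => (f i).succ) M)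
      (rename (Fin.cons 0 fun i => (f i).succ) N)
  | _, _, f, pair M N => pair (rename f M) (rename f N)
  | _, _, f, fst M => fst (rename f M)
  | _, _, f, snd M => snd (rename f M)
  | _, _, f, lam σ M => lam σ (rename (Fin.cons 0 fun i => (f i).succ) M)
  | _, _, f, app M N => app (rename f M) (rename f N)
  | _, _, f, fold M => fold (rename f M)
  | _, _, f, unfold M => unfold (rename f M)

/-- A substitution under a binder. -/
def up {n m : ℕ} (s : Fin n → Tm m) : Fin (n + 1) → Tm (m + 1) :=
  Fin.cons (var 0) fun i => (s i).rename Fin.succ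

/-- Simultaneous capture-avoiding substitution. -/
def subst : {n m : ℕ} → (Fin n → Tm m) → Tm n → Tm m
  | _, _, s, var i => s i
  | _, _, _, unit => unit
  | _, _, s, inl M => inl (subst s M)
  | _, _, s, inr M => inr (subst s M)
  | _, _, s, case L M N => case (subst s L) (subst (up s) M) (subst (up s) N)
  | _, _, s, pair M N => pair (subst s M) (subst s N)
  | _, _, s, fst M => fst (subst s M)
  | _, _, s, snd M => snd (subst s M)
  | _, _, s, lam σ M => lam σ (subst (up s) M)
  | _, _, s, app M N => app (subst s M) (subst s N)
  | _, _, s, fold M => fold (subst s M)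
  | _, _, s, unfold M => unfold (subst s M)

/-- `M[N/x]`, where `x` is the innermost variable. -/
def inst {n : ℕ} (M : Tm (n + 1)) (N : Tm n) : Tm n := M.subst (Fin.cons N var)

/-- Values: closed terms whose outermost construct is an introduction form. -/
inductive IsValue : Tm 0 → Prop
  | unit : IsValue unit
  | inl (M : Tm 0) : IsValue (inl M)
  | inr (M : Tm 0) : IsValue (inr M)
  | pair (M N : Tm 0) : IsValue (pair M N)
  | lam (σ : Ty 0) (M : Tm 1) : IsValue (lam σ M)
  | fold (M : Tm 0) : IsValue (fold M)

/-- The call-by-name big-step operational semantics: `BigStep M k v` is `M ⇓^k v`, where `k` counts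
the unfold-fold reductions. -/
inductive BigStep : Tm 0 → ℕ → Tm 0 → Prop
  | val {v : Tm 0} (hv : IsValue v) : BigStep v 0 v
  | case_inl {L L' v : Tm 0} {M N : Tm 1} {k m : ℕ} (hL : BigStep L k (inl L'))
      (hM : BigStep (M.inst L') m v) : BigStep (case L M N) (m + k) v
  | case_inr {L L' v : Tm 0} {M N : Tm 1} {k m : ℕ} (hL : BigStep L k (inr L'))
      (hN : BigStep (N.inst L') m v) : BigStep (case L M N) (m + k) v
  | fst {L M N v : Tm 0} {k l : ℕ} (hL : BigStep L k (pair M N)) (hM : BigStep M l v) :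
      BigStep (fst L) (k + l) v
  | snd {L M N v : Tm 0} {k l : ℕ} (hL : BigStep L k (pair M N)) (hN : BigStep N l v) :
      BigStep (snd L) (k + l) v
  | app {M N v : Tm 0} {σ : Ty 0} {L : Tm 1} {k l : ℕ} (hM : BigStep M k (lam σ L))
      (hL : BigStep (L.inst N) l v) : BigStep (app M N) (k + l) v
  | unfold {M N v : Tm 0} {k m : ℕ} (hM : BigStep M k (fold N)) (hN : BigStep N m v) :
      BigStep (unfold M) (k + m + 1) v

end Tm

/-- Contexts: the variable with de Bruijn index `i` has the closed type `Γ i`. -/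
abbrev Ctx (n : ℕ) : Type := Fin n → Ty 0

/-- The extension `Γ, x : σ` of a context. -/
def Ctx.snoc {n : ℕ} (Γ : Ctx n) (σ : Ty 0) : Ctx (n + 1) := Fin.cons σ Γ

/-- The empty context. -/
def Ctx.nil : Ctx 0 := Fin.elim0

/-- Typing judgements: the elements of `Typing Γ M τ` are the derivations of `Γ ⊢ M : τ`. -/
inductive Typing : {n : ℕ} → Ctx n → Tm n → Ty 0 → Type
  | var {n : ℕ} {Γ : Ctx n} (i : Fin n) : Typing Γ (.var i) (Γ i)
  | unit {n : ℕ} {Γ : Ctx n} : Typing Γ .unit .unit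
  | lam {n : ℕ} {Γ : Ctx n} {σ τ : Ty 0} {M : Tm (n + 1)} (d : Typing (Γ.snoc σ) M τ) :
      Typing Γ (.lam σ M) (.arrow σ τ)
  | app {n : ℕ} {Γ : Ctx n} {σ τ : Ty 0} {M N : Tm n} (d : Typing Γ M (.arrow σ τ))
      (e : Typing Γ N σ) : Typing Γ (.app M N) τ
  | inl {n : ℕ} {Γ : Ctx n} {σ τ : Ty 0} {M : Tm n} (d : Typing Γ M σ) :
      Typing Γ (.inl M) (.sum σ τ)
  | inr {n : ℕ} {Γ : Ctx n} {σ τ : Ty 0} {M : Tm n} (d : Typing Γ M τ) :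
      Typing Γ (.inr M) (.sum σ τ)
  | case {n : ℕ} {Γ : Ctx n} {σ₁ σ₂ τ : Ty 0} {L : Tm n} {M N : Tm (n + 1)}
      (c : Typing Γ L (.sum σ₁ σ₂)) (d : Typing (Γ.snoc σ₁) M τ) (e : Typing (Γ.snoc σ₂) N τ) :
      Typing Γ (.case L M N) τ
  | pair {n : ℕ} {Γ : Ctx n} {σ τ : Ty 0} {M N : Tm n} (d : Typing Γ M σ) (e : Typing Γ N τ) :
      Typing Γ (.pair M N) (.prod σ τ)
  | fst {n : ℕ} {Γ : Ctx n} {σ τ : Ty 0} {M : Tm n} (d : Typing Γ M (.prod σ τ)) :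
      Typing Γ (.fst M) σ
  | snd {n : ℕ} {Γ : Ctx n} {σ τ : Ty 0} {M : Tm n} (d : Typing Γ M (.prod σ τ)) :
      Typing Γ (.snd M) τ
  | unfold {n : ℕ} {Γ : Ctx n} {τ : Ty 1} {M : Tm n} (d : Typing Γ M (.mu τ)) :
      Typing Γ (.unfold M) (τ.inst (.mu τ))
  | fold {n : ℕ} {Γ : Ctx n} {τ : Ty 1} {M : Tm n} (d : Typing Γ M (τ.inst (.mu τ))) :
      Typing Γ (.fold M) (.mu τ)

/-- The interpretation of contexts, as products. -/
noncomputable abbrev Ctx.den {n : ℕ} (Γ : Ctx n) : Obj := pi fun i => (Γ i).den₀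

/-- Extension of environments. -/
noncomputable def Ctx.push {n : ℕ} (Γ : Ctx n) (σ : Ty 0) :
    Hom (Obj.prod Γ.den σ.den₀) (Γ.snoc σ).den :=
  Hom.tuple fun i => Fin.cases (motive := fun i => Hom (Obj.prod Γ.den σ.den₀) (Γ.snoc σ i).den₀)
    (Hom.snd _ _) (fun i => (Hom.fst _ _).comp (Hom.proj _ i)) i

/-- The interpretation of typing judgements `Γ ⊢ M : τ` as morphisms `⟦Γ⟧ → ⟦τ⟧`. -/
noncomputable def Typing.den : {n : ℕ} → {Γ : Ctx n} → {M : Tm n} → {τ : Ty 0} →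
    Typing Γ M τ → Hom Γ.den τ.den₀
  | _, _, _, _, @Typing.var _ Γ i => Hom.proj (fun i => (Γ i).den₀) i
  | _, _, _, _, .unit => (Hom.toOne _).comp (Hom.now one)
  | _, Γ, _, _, @Typing.lam _ _ σ _ _ d => Hom.curry ((Γ.push σ).comp d.den)
  | _, _, _, _, @Typing.app _ _ σ τ _ _ d e => (Hom.pair d.den e.den).comp (Hom.eval σ.den₀ τ.den₀)
  | _, _, _, _, @Typing.inl _ _ σ τ _ d => (d.den.comp (Hom.inl σ.den₀ τ.den₀)).comp (Hom.now _)
  | _, _, _, _, @Typing.inr _ _ σ τ _ d => (d.den.comp (Hom.inr σ.den₀ τ.den₀)).comp (Hom.now _)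
  | _, Γ, _, _, @Typing.case _ _ σ₁ σ₂ τ _ _ _ c d e =>
      (Hom.pair (Hom.id _) c.den).comp
        (Hom.extend τ.tick (Hom.cases ((Γ.push σ₁).comp d.den) ((Γ.push σ₂).comp e.den)))
  | _, _, _, _, .pair d e => Hom.pair d.den e.den
  | _, _, _, _, @Typing.fst _ _ σ τ _ d => d.den.comp (Hom.fst σ.den₀ τ.den₀)
  | _, _, _, _, @Typing.snd _ _ σ τ _ d => d.den.comp (Hom.snd σ.den₀ τ.den₀)
  | _, _, _, _, @Typing.unfold _ _ τ _ d =>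
      (d.den.comp (Hom.ofEq (Ty.den_mu τ _))).comp (Ty.tick (τ.inst (.mu τ)))
  | _, _, _, _, @Typing.fold _ _ τ _ d =>
      (d.den.comp (Hom.next _)).comp (Hom.ofEq (Ty.den_mu τ _).symm)

/-- The global interpretation `⟦M⟧^gl : ∀ κ. ⟦τ⟧` of a closed term of type `τ`. -/
noncomputable def Typing.denGlob {M : Tm 0} {τ : Ty 0} (d : Typing Ctx.nil M τ) : Glob τ.den₀ where
  val n := d.den.app n fun i => i.elim0
  compat n := (d.den.nat n fun i => i.elim0).trans
    (congrArg (d.den.app n) (funext fun i => i.elim0))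

/-! ### Execution of the denotational semantics -/

/-- The type `1 + 1` of booleans. -/
abbrev Ty.bool : Ty 0 := .sum .unit .unit

/-- The global interpretation `∀ κ. L (L 1 + L 1)` of the type `1 + 1`. -/
abbrev BoolGlob : Type := Glob (lift (sum (lift one) (lift one)))

/-- Run the denotation of a boolean program for one step. -/
noncomputable def runstep (x : BoolGlob) : (Unit ⊕ Unit) ⊕ BoolGlob :=
  match (x.map (Hom.liftUnfold _)).distrib with
  | .inl y => match y.distrib with
    | .inl _ => .inl (.inl ())
    | .inr _ => .inl (.inr ())
  | .inr z => .inr z.force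

/-- Iterate `runstep` until it gets a result, or for at most `n + 1` times. -/
noncomputable def exec : ℕ → BoolGlob → (Unit ⊕ Unit) ⊕ BoolGlob
  | 0, x => runstep x
  | n + 1, x => match runstep x with
    | .inl b => .inl b
    | .inr y => exec n y

end FPC

namespace FPC

open Obj

namespace Tm

/-! ### Syntactic substitution -/

/-! Soundness and adequacy are proved together, by one step-indexed logical relation `Rel` between
denotations at stage `n` and closed terms. The operational side is measured by `Reduces c M M'`, an
equivalence between evaluations of `M` and evaluations of `M'` that are `c` steps cheaper. Because
it is an equivalence with an exact count, being related to a denotation `θ r` also excludes every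
evaluation of the term in zero steps. No small-step semantics is needed.

At sums and the unit type, `η` is matched by zero steps and each `θ` by exactly one. At `μ` the type
does not shrink under unfolding, but the stage drops by one, so the relation is well defined by
recursion on stages and, within a stage, on types. The central property is `rel_tick`: if `M` takes
one step to `M'` and `M'` is related to `r` one stage later, then `M` is related to `θ r` at every
type. With closure under zero-step expansion (`Rel.expand`) and restriction (`Rel.mono`), this
yields the fundamental theorem `Typing.rel`: every term is related to its denotation.

At `1 + 1`, each `runstep` that returns a new computation then strips one `θ` and one operational
step. Induction on `n` gives the equivalence (`exec_eq_inl_iff`). -/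

theorem rename_subst {n : ℕ} (M : Tm n) : ∀ {m l : ℕ} (f : Fin n → Fin m) (s : Fin m → Tm l),
    (M.rename f).subst s = M.subst fun i => s (f i) := by
  -- Only binders are not immediate. This fact and the induction hypotheses all reach the final
  -- `simp only` through `*`.
  have hup : ∀ {n m l : ℕ} (f : Fin n → Fin m) (s : Fin m → Tm l),
      (fun i => up s ((Fin.cons 0 fun i => (f i).succ : Fin (n + 1) → Fin (m + 1)) i)) =
        up fun i => s (f i) := by
    intro n m l f s
    funext i
    refine Fin.cases ?_ (fun i => ?_) i <;> rfl
  induction M <;> intros <;> simp only [rename, subst, *]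

theorem rename_rename {n : ℕ} (M : Tm n) : ∀ {m l : ℕ} (f : Fin n → Fin m) (g : Fin m → Fin l),
    (M.rename f).rename g = M.rename fun i => g (f i) := by
  have hup : ∀ {n m l : ℕ} (f : Fin n → Fin m) (g : Fin m → Fin l),
      (fun i => (Fin.cons 0 fun i => (g i).succ : Fin (m + 1) → Fin (l + 1))
        ((Fin.cons 0 fun i => (f i).succ : Fin (n + 1) → Fin (m + 1)) i)) =
        Fin.cons 0 fun i => (g (f i)).succ := by
    intro n m l f g
    funext i
    refine Fin.cases ?_ (fun i => ?_) i <;> rfl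
  induction M <;> intros <;> simp only [rename, *]

theorem subst_rename {n : ℕ} (M : Tm n) : ∀ {m l : ℕ} (s : Fin n → Tm m) (f : Fin m → Fin l),
    (M.subst s).rename f = M.subst fun i => (s i).rename f := by
  have hup : ∀ {n m l : ℕ} (s : Fin n → Tm m) (f : Fin m → Fin l),
      (fun i => (up s i).rename (Fin.cons 0 fun i => (f i).succ)) =
        up fun i => (s i).rename f := by
    intro n m l s f
    funext i
    refine Fin.cases ?_ (fun i => ?_) i
    · rfl
    · simp [up, rename_rename]
  induction M <;> intros <;> simp only [rename, subst, *]

/-- Passing under a binder weakens the substituted terms, so this law needs the mixed laws for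
renaming and substitution, and `subst_rename` in turn needs `rename_rename`. -/
theorem subst_subst {n : ℕ} (M : Tm n) : ∀ {m l : ℕ} (s : Fin n → Tm m) (t : Fin m → Tm l),
    (M.subst s).subst t = M.subst fun i => (s i).subst t := by
  have hup : ∀ {n m l : ℕ} (s : Fin n → Tm m) (t : Fin m → Tm l),
      (fun i => (up s i).subst (up t)) = up fun i => (s i).subst t := by
    intro n m l s t
    funext i
    refine Fin.cases ?_ (fun i => ?_) i
    · rfl
    · simp [up, rename_subst, subst_rename]
  induction M <;> intros <;> simp only [subst, *]

theorem subst_var {n : ℕ} (M : Tm n) : M.subst var = M := by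
  have hup : ∀ n : ℕ, up (var : Fin n → Tm n) = var := by
    intro n
    funext i
    refine Fin.cases ?_ (fun i => ?_) i <;> rfl
  induction M <;> simp only [subst, *]

/-- A contracted redex of a closed instance is again an instance by an extended closing
substitution. This is the form in which the fundamental theorem meets its induction hypotheses under
binders. -/
theorem subst_up_inst {n m : ℕ} (M : Tm (n + 1)) (s : Fin n → Tm m) (N : Tm m) :
    (M.subst (up s)).inst N = M.subst (Fin.cons N s) := by
  refine (subst_subst M _ _).trans (congrArg (fun t => subst t M) (funext fun i => ?_))
  refine Fin.cases ?_ (fun i => ?_) i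
  · rfl
  · exact (rename_subst (s i) _ _).trans (subst_var (s i))

/-! ### Reduction in a given number of unfold-fold steps, up to evaluation -/

/-- `M` evaluates exactly as `M'` does, with `c` additional unfold-fold reductions. -/
def Reduces (c : ℕ) (M M' : Tm 0) : Prop :=
  ∀ k v, BigStep M k v ↔ ∃ k', k = k' + c ∧ BigStep M' k' v

namespace Reduces

theorem refl (M : Tm 0) : Reduces 0 M M := fun k v =>
  ⟨fun h => ⟨k, rfl, h⟩, by rintro ⟨k', rfl, h⟩; exact h⟩

theorem trans {c c' : ℕ} {M M' M'' : Tm 0} (h : Reduces c M M') (h' : Reduces c' M' M'') :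
    Reduces (c' + c) M M'' := by
  intro k v
  rw [h k v]
  constructor
  · rintro ⟨k₁, rfl, e⟩
    obtain ⟨k₂, rfl, e'⟩ := (h' _ _).1 e
    exact ⟨k₂, Nat.add_assoc _ _ _, e'⟩
  · rintro ⟨k₂, rfl, e⟩
    exact ⟨k₂ + c', (Nat.add_assoc _ _ _).symm, (h' _ _).2 ⟨k₂, rfl, e⟩⟩

/-- Two terms reached in the same number of steps evaluate alike. -/
theorem confluent {c : ℕ} {M M' M'' : Tm 0} (h : Reduces c M M') (h' : Reduces c M M'') :
    Reduces 0 M' M'' := by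
  intro k v
  -- Evaluations of `M'` and of `M''` in `k` steps both correspond to evaluations of `M` in `k + c`
  -- steps, and `c` cancels.
  have e := (h (k + c) v).symm.trans (h' (k + c) v)
  constructor
  · intro hk
    obtain ⟨k', h1, h2⟩ := e.1 ⟨k, rfl, hk⟩
    exact ⟨k', Nat.add_right_cancel h1, h2⟩
  · rintro ⟨k', rfl, hk⟩
    obtain ⟨k'', h1, h2⟩ := e.2 ⟨k, rfl, hk⟩
    obtain rfl := Nat.add_right_cancel h1
    exact h2

/-- Evaluating an eliminator evaluates its principal argument and adds up the counts, so a surplus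
of `c` there is a surplus of `c` overall. The same reason gives the congruences for the other
eliminators. -/
theorem case {c : ℕ} {L L' : Tm 0} (h : Reduces c L L') (M N : Tm 1) :
    Reduces c (.case L M N) (.case L' M N) := by
  intro k v
  constructor
  -- Inversion of the evaluation; the value rule is excluded because an elimination form is not a
  -- value.
  · rintro (⟨⟨⟩⟩ | ⟨hL, hM⟩ | ⟨hL, hM⟩)
    · obtain ⟨k', rfl, hL'⟩ := (h _ _).1 hL
      exact ⟨_, (Nat.add_assoc _ _ _).symm, .case_inl hL' hM⟩
    · obtain ⟨k', rfl, hL'⟩ := (h _ _).1 hL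
      exact ⟨_, (Nat.add_assoc _ _ _).symm, .case_inr hL' hM⟩
  · rintro ⟨k', rfl, (⟨⟨⟩⟩ | ⟨hL, hM⟩ | ⟨hL, hM⟩)⟩
    · rw [Nat.add_assoc]
      exact .case_inl ((h _ _).2 ⟨_, rfl, hL⟩) hM
    · rw [Nat.add_assoc]
      exact .case_inr ((h _ _).2 ⟨_, rfl, hL⟩) hM

theorem fst {c : ℕ} {L L' : Tm 0} (h : Reduces c L L') : Reduces c (.fst L) (.fst L') := by
  intro k v
  constructor
  · rintro (⟨⟨⟩⟩ | _ | _ | ⟨hL, hM⟩)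
    obtain ⟨k', rfl, hL'⟩ := (h _ _).1 hL
    exact ⟨_, Nat.add_right_comm _ _ _, .fst hL' hM⟩
  · rintro ⟨k', rfl, (⟨⟨⟩⟩ | _ | _ | ⟨hL, hM⟩)⟩
    rw [Nat.add_right_comm]
    exact .fst ((h _ _).2 ⟨_, rfl, hL⟩) hM

theorem snd {c : ℕ} {L L' : Tm 0} (h : Reduces c L L') : Reduces c (.snd L) (.snd L') := by
  intro k v
  constructor
  · rintro (⟨⟨⟩⟩ | _ | _ | _ | ⟨hL, hM⟩)
    obtain ⟨k', rfl, hL'⟩ := (h _ _).1 hL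
    exact ⟨_, Nat.add_right_comm _ _ _, .snd hL' hM⟩
  · rintro ⟨k', rfl, (⟨⟨⟩⟩ | _ | _ | _ | ⟨hL, hM⟩)⟩
    rw [Nat.add_right_comm]
    exact .snd ((h _ _).2 ⟨_, rfl, hL⟩) hM

theorem app {c : ℕ} {L L' : Tm 0} (h : Reduces c L L') (N : Tm 0) :
    Reduces c (.app L N) (.app L' N) := by
  intro k v
  constructor
  · rintro (⟨⟨⟩⟩ | _ | _ | _ | _ | ⟨hL, hM⟩)
    obtain ⟨k', rfl, hL'⟩ := (h _ _).1 hL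
    exact ⟨_, Nat.add_right_comm _ _ _, .app hL' hM⟩
  · rintro ⟨k', rfl, (⟨⟨⟩⟩ | _ | _ | _ | _ | ⟨hL, hM⟩)⟩
    rw [Nat.add_right_comm]
    exact .app ((h _ _).2 ⟨_, rfl, hL⟩) hM

theorem unfold {c : ℕ} {L L' : Tm 0} (h : Reduces c L L') :
    Reduces c (.unfold L) (.unfold L') := by
  intro k v
  constructor
  · rintro (⟨⟨⟩⟩ | _ | _ | _ | _ | _ | ⟨hL, hM⟩)
    obtain ⟨k', rfl, hL'⟩ := (h _ _).1 hL
    exact ⟨_, by omega, .unfold hL' hM⟩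
  · rintro ⟨k', rfl, (⟨⟨⟩⟩ | _ | _ | _ | _ | _ | @⟨_, _, _, k, m, hL, hM⟩)⟩
    rw [show k + m + 1 + c = (k + c) + m + 1 by omega]
    exact .unfold ((h _ _).2 ⟨_, rfl, hL⟩) hM

/-- A value evaluates only to itself, in no steps, so inverting the evaluation of a redex leaves
only the evaluation of its contractum. The other β-rules follow in the same way. -/
theorem case_inl (L : Tm 0) (M N : Tm 1) : Reduces 0 (.case (.inl L) M N) (M.inst L) := by
  intro k v
  constructor
  · rintro (⟨⟨⟩⟩ | ⟨⟨⟩, hM⟩ | ⟨⟨⟩, hM⟩)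
    exact ⟨_, rfl, hM⟩
  · rintro ⟨k, rfl, hM⟩
    exact .case_inl (.val (.inl L)) hM

theorem case_inr (L : Tm 0) (M N : Tm 1) : Reduces 0 (.case (.inr L) M N) (N.inst L) := by
  intro k v
  constructor
  · rintro (⟨⟨⟩⟩ | ⟨⟨⟩, hM⟩ | ⟨⟨⟩, hM⟩)
    exact ⟨_, rfl, hM⟩
  · rintro ⟨k, rfl, hM⟩
    exact .case_inr (.val (.inr L)) hM

theorem fst_pair (M N : Tm 0) : Reduces 0 (.fst (.pair M N)) M := by
  intro k v
  constructor
  · rintro (⟨⟨⟩⟩ | _ | _ | ⟨⟨⟩, hM⟩)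
    exact ⟨_, by omega, hM⟩
  · rintro ⟨k, rfl, hM⟩
    have := BigStep.fst (.val (.pair M N)) hM
    rwa [Nat.zero_add] at this

theorem snd_pair (M N : Tm 0) : Reduces 0 (.snd (.pair M N)) N := by
  intro k v
  constructor
  · rintro (⟨⟨⟩⟩ | _ | _ | _ | ⟨⟨⟩, hM⟩)
    exact ⟨_, by omega, hM⟩
  · rintro ⟨k, rfl, hM⟩
    have := BigStep.snd (.val (.pair M N)) hM
    rwa [Nat.zero_add] at this

theorem app_lam (σ : Ty 0) (M : Tm 1) (N : Tm 0) :
    Reduces 0 (.app (.lam σ M) N) (M.inst N) := by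
  intro k v
  constructor
  · rintro (⟨⟨⟩⟩ | _ | _ | _ | _ | ⟨⟨⟩, hM⟩)
    exact ⟨_, by omega, hM⟩
  · rintro ⟨k, rfl, hM⟩
    have := BigStep.app (.val (.lam σ M)) hM
    rwa [Nat.zero_add] at this

/-- The only β-rule with a cost: the extra `1` in the evaluation rule for `unfold`. -/
theorem unfold_fold (M : Tm 0) : Reduces 1 (.unfold (.fold M)) M := by
  intro k v
  constructor
  · rintro (⟨⟨⟩⟩ | _ | _ | _ | _ | _ | ⟨⟨⟩, hM⟩)
    exact ⟨_, by omega, hM⟩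
  · rintro ⟨k, rfl, hM⟩
    have := BigStep.unfold (.val (.fold M)) hM
    rwa [Nat.zero_add] at this

end Reduces

end Tm

open Tm

/-! ### The `▷`-algebra structures -/

namespace Ty

/-- The guarded recursive assumption in the definition of `tickAll`, at stage `n`. -/
noncomputable def tickPrev (n : ℕ) : (later AlgObj).T n := (Hom.next AlgObj).app n (tickAll.val n)

theorem tickPrev_succ (n : ℕ) : tickPrev (n + 1) = tickAll.val n := tickAll.compat n

theorem tickPrev_r (n : ℕ) : (later AlgObj).r n (tickPrev (n + 1)) = tickPrev n := by
  unfold tickPrev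
  rw [(Hom.next AlgObj).nat, tickAll.compat]

/-- One unfolding of the guarded fixed point. All later equations for `tick` are read off from
`tickStep` through it. -/
theorem tick_app (σ : Ty 0) (n : ℕ) (x : (later (den₀ σ)).T n) :
    (tick σ).app n x = (tickStep σ).app n (tickPrev n, x) := by
  have h : tickAll.val n = (Hom.tuple fun σ => Hom.curry (tickStep σ)).app n (tickPrev n) := by
    cases n with
    | zero => rfl
    | succ n => rw [tickPrev_succ]; rfl
  change (tickAll.val n σ).1 n le_rfl x = _
  rw [h]
  change (tickStep σ).app n ((later AlgObj).res _ (tickPrev n), x) = _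
  rw [res_self]

theorem tick_unit (n : ℕ) (x : (later (den₀ unit)).T n) :
    (tick unit).app n x = (Hom.tickL one).app n x := by
  rw [tick_app, tickStep]
  rfl

theorem tick_sum (σ τ : Ty 0) (n : ℕ) (x : (later (den₀ (sum σ τ))).T n) :
    (tick (sum σ τ)).app n x = (Hom.tickL (Obj.sum (den₀ σ) (den₀ τ))).app n x := by
  rw [tick_app, tickStep]
  rfl

theorem tick_prod (σ τ : Ty 0) (n : ℕ) (x : (later (den₀ (prod σ τ))).T n) :
    (tick (prod σ τ)).app n x =
      ((tick σ).app n ((Hom.laterMap (Hom.fst (den₀ σ) (den₀ τ))).app n x),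
        (tick τ).app n ((Hom.laterMap (Hom.snd (den₀ σ) (den₀ τ))).app n x)) := by
  rw [tick_app, tick_app, tick_app, tickStep]
  rfl

/-- Currying restricts the pair of recursive assumption and argument to stage `j`. The assumption at
stage `n` restricts to the one at stage `j`, so the value is given by `tick τ` at stage `j`. -/
theorem tick_arrow (σ τ : Ty 0) (n : ℕ) (x : (later (den₀ (arrow σ τ))).T n) (j : ℕ) (h : j ≤ n)
    (y : (den₀ σ).T j) :
    ((tick (arrow σ τ)).app n x).1 j h y = (tick τ).app j
      ((Hom.laterApp (den₀ σ) (den₀ τ)).app j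
        ((later (den₀ (arrow σ τ))).res h x, (Hom.next (den₀ σ)).app j y)) := by
  have hr : ∀ {j : ℕ} (h : j ≤ n), (Obj.prod (later AlgObj) (later (den₀ (arrow σ τ)))).res h
      (tickPrev n, x) = (tickPrev j, (later (den₀ (arrow σ τ))).res h x) := by
    intro j h
    induction h using Nat.decreasingInduction with
    | self => rw [res_self, res_self]
    | of_succ k hk ih =>
      rw [← res_r _ hk, ih, ← res_r _ hk]
      exact Prod.ext (tickPrev_r k) rfl
  rw [tick_app, tick_app, tickStep]
  change (tickStep τ).app j (((Obj.prod (later AlgObj) (later (den₀ (arrow σ τ)))).res h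
      (tickPrev n, x)).1, (Hom.laterApp (den₀ σ) (den₀ τ)).app j
      (((Obj.prod (later AlgObj) (later (den₀ (arrow σ τ)))).res h (tickPrev n, x)).2, _)) = _
  rw [hr h]
  rfl

/-- The morphism `⟦μ α. τ⟧ → ▷ ⟦τ[μ α. τ/α]⟧`. -/
noncomputable abbrev muUnfold (τ : Ty 1) : Hom (den₀ (mu τ)) (later (den₀ (τ.inst (mu τ)))) :=
  Hom.ofEq (den_mu τ _)

theorem ofEq_ofEq_symm {X Y : Obj} (h : X = Y) (n : ℕ) (y : Y.T n) :
    (Hom.ofEq h).app n ((Hom.ofEq h.symm).app n y) = y := by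
  subst h
  rfl

/-- The only clause that uses the recursive assumption: the larger type `τ.inst (mu τ)` appears on
the right, but one stage earlier. Inductions on the stage rely on this drop. -/
theorem tick_mu (τ : Ty 1) (n : ℕ) (x : (den₀ (mu τ)).T n) :
    (muUnfold τ).app (n + 1) ((tick (mu τ)).app (n + 1) x) =
      (tick (τ.inst (mu τ))).app n ((muUnfold τ).app n x) := by
  refine (congrArg ((muUnfold τ).app (n + 1)) (tick_app (mu τ) (n + 1) x)).trans ?_
  rw [tickStep]
  refine (ofEq_ofEq_symm (den_mu τ Fin.elim0) (n + 1) _).trans ?_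
  exact congrArg (fun p : AlgObj.T n => (p (τ.inst (mu τ))).1 n le_rfl ((muUnfold τ).app n x))
    (tickPrev_succ n)

end Ty

open Ty

/-! ### The logical relation -/

/-- Relational lifting along `L`. -/
def LiftRel {A : Obj} (P : ∀ n, A.T n → Tm 0 → Prop) : ∀ n, (lift A).T n → Tm 0 → Prop
  | 0, .inl a, M => P 0 a M
  -- The first stage already records that a step is taken, though nothing about the term it leads
  -- to.
  | 0, .inr _, M => ∃ M', Reduces 1 M M'
  | n + 1, .inl a, M => P (n + 1) a M
  | n + 1, .inr y, M => ∃ M', Reduces 1 M M' ∧ LiftRel P n y M'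

/-- Relational lifting along `▷`. -/
def LaterRel {X : Obj} (P : ∀ n, X.T n → Tm 0 → Prop) : ∀ n, (later X).T n → Tm 0 → Prop
  | 0, _, _ => True
  | n + 1, x, M => P n x M

/-- The relation on sums, for terms which evaluate in no steps. -/
def SumRel {X Y : Obj} (P : ∀ n, X.T n → Tm 0 → Prop) (Q : ∀ n, Y.T n → Tm 0 → Prop) (n : ℕ) :
    (Obj.sum X Y).T n → Tm 0 → Prop
  | .inl x, M => ∃ L, Reduces 0 M (.inl L) ∧ P n x L
  | .inr y, M => ∃ L, Reduces 0 M (.inr L) ∧ Q n y L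

theorem LiftRel.congr {A : Obj} {P Q : ∀ n, A.T n → Tm 0 → Prop} {n : ℕ}
    (h : ∀ j, j ≤ n → P j = Q j) : LiftRel P n = LiftRel Q n := by
  funext x M
  induction n generalizing M with
  | zero =>
    obtain a | y := x
    · exact congrFun₂ (h 0 le_rfl) a M
    · rfl
  | succ n ih =>
    obtain a | y := x
    · exact congrFun₂ (h _ le_rfl) a M
    · exact congrArg Exists (funext fun M' => congrArg (_ ∧ ·)
        (ih (fun j hj => h j (hj.trans (Nat.le_succ n))) y M'))

theorem LaterRel.congr {X : Obj} {P Q : ∀ n, X.T n → Tm 0 → Prop} {n : ℕ}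
    (h : ∀ j, j < n → P j = Q j) : LaterRel P n = LaterRel Q n := by
  cases n with
  | zero => rfl
  | succ n => exact h n n.lt_succ_self

/-- The logical relation between denotations and closed terms, relative to the relation `R` at
the earlier stages. -/
def relStep (R : ∀ (σ : Ty 0) (n : ℕ), (den₀ σ).T n → Tm 0 → Prop) :
    ∀ (σ : Ty 0) (n : ℕ), (den₀ σ).T n → Tm 0 → Prop
  | .unit, n => LiftRel (A := one) (fun _ _ M => Reduces 0 M .unit) n
  | .prod σ τ, n => fun x M => relStep R σ n x.1 (.fst M) ∧ relStep R τ n x.2 (.snd M)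
  | .sum σ τ, n => LiftRel (SumRel (relStep R σ) (relStep R τ)) n
  | .arrow σ τ, n => fun f M => ∀ (j : ℕ) (h : j ≤ n) (y : (den₀ σ).T j) (N : Tm 0),
      relStep R σ j y N → relStep R τ j (f.1 j h y) (.app M N)
  -- Recursion on types cannot reach the unfolded type, so `R` supplies its relation, guarded by
  -- `LaterRel`. The `1` is the cost of the unfold-fold reduction.
  | .mu τ, n => fun x M => ∃ M', Reduces 1 (.unfold M) M' ∧
      LaterRel (R (τ.inst (.mu τ))) n ((muUnfold τ).app n x) M'

/-- Contractiveness: `R` is consulted only at recursive types, under `LaterRel`, hence only at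
strictly earlier stages. -/
theorem relStep_congr {R R' : ∀ (σ : Ty 0) (n : ℕ), (den₀ σ).T n → Tm 0 → Prop} {n : ℕ}
    (h : ∀ σ j, j < n → R σ j = R' σ j) :
    ∀ (σ : Ty 0) (j : ℕ), j ≤ n → relStep R σ j = relStep R' σ j
  | .unit, j, _ => by rw [relStep, relStep]
  | .prod σ τ, j, hj => by
    unfold relStep
    rw [relStep_congr h σ j hj, relStep_congr h τ j hj]
  | .sum σ τ, j, hj => by
    rw [relStep, relStep]
    refine LiftRel.congr fun i hi => funext fun x => ?_
    have hσ := relStep_congr h σ i (hi.trans hj)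
    have hτ := relStep_congr h τ i (hi.trans hj)
    obtain x | x := x <;> unfold SumRel
    · rw [hσ]
    · rw [hτ]
  | .arrow σ τ, j, hj => by
    unfold relStep
    funext f M
    refine forall_congr fun i => forall_congr fun hi => ?_
    rw [relStep_congr h σ i (hi.trans hj), relStep_congr h τ i (hi.trans hj)]
  | .mu τ, j, hj => by
    unfold relStep
    rw [LaterRel.congr fun i hi => h _ i (hi.trans_le hj)]

/-- Approximations of the logical relation, correct before stage `k`. -/
def relApprox : ℕ → ∀ (σ : Ty 0) (n : ℕ), (den₀ σ).T n → Tm 0 → Prop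
  | 0 => fun _ _ _ _ => True
  | k + 1 => relStep (relApprox k)

/-- The logical relation between denotations at stage `n` and closed terms. -/
def Rel (σ : Ty 0) (n : ℕ) : (den₀ σ).T n → Tm 0 → Prop := relApprox (n + 1) σ n

theorem relApprox_eq {k : ℕ} (σ : Ty 0) {n : ℕ} (h : n < k) : relApprox k σ n = Rel σ n := by
  have step : ∀ k σ n, n < k → relApprox (k + 1) σ n = relApprox k σ n := by
    intro k
    induction k with
    | zero => exact fun σ n h => absurd h n.not_lt_zero
    | succ k ih => exact fun σ n h => relStep_congr ih σ n (Nat.le_of_lt_succ h)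
  induction k, h using Nat.le_induction with
  | base => rfl
  | succ k hk ih => exact (step k σ n hk).trans ih

/-- The fixed point equation. At stage `n`, `Rel` is one step applied to `relApprox n`, which agrees
with `Rel` at all the stages that this step consults. -/
theorem rel_eq (σ : Ty 0) (n : ℕ) : Rel σ n = relStep Rel σ n :=
  relStep_congr (fun σ _ h => relApprox_eq σ h) σ n le_rfl

theorem relStep_rel : relStep Rel = Rel := by
  funext σ n
  exact (rel_eq σ n).symm

theorem rel_unit : Rel .unit = LiftRel (A := one) (fun _ _ M => Reduces 0 M .unit) := by
  funext n
  rw [rel_eq, relStep]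

theorem rel_sum (σ τ : Ty 0) : Rel (.sum σ τ) = LiftRel (SumRel (Rel σ) (Rel τ)) := by
  funext n
  rw [rel_eq]
  unfold relStep
  rw [relStep_rel]

theorem rel_prod (σ τ : Ty 0) (n : ℕ) (x : (den₀ (.prod σ τ)).T n) (M : Tm 0) :
    Rel (.prod σ τ) n x M ↔ Rel σ n x.1 (.fst M) ∧ Rel τ n x.2 (.snd M) := by
  rw [rel_eq]
  unfold relStep
  rw [relStep_rel]

theorem rel_arrow (σ τ : Ty 0) (n : ℕ) (f : (den₀ (.arrow σ τ)).T n) (M : Tm 0) :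
    Rel (.arrow σ τ) n f M ↔ ∀ (j : ℕ) (h : j ≤ n) (y : (den₀ σ).T j) (N : Tm 0),
      Rel σ j y N → Rel τ j (f.1 j h y) (.app M N) := by
  rw [rel_eq]
  unfold relStep
  rw [relStep_rel]

theorem rel_mu (τ : Ty 1) (n : ℕ) (x : (den₀ (.mu τ)).T n) (M : Tm 0) :
    Rel (.mu τ) n x M ↔ ∃ M', Reduces 1 (.unfold M) M' ∧
      LaterRel (Rel (τ.inst (.mu τ))) n ((muUnfold τ).app n x) M' := by
  rw [rel_eq, relStep]

/-! ### Closure properties of the logical relation -/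

theorem liftRel_now {A : Obj} (P : ∀ n, A.T n → Tm 0 → Prop) (n : ℕ) (a : A.T n) (M : Tm 0) :
    LiftRel P n ((Hom.now A).app n a) M ↔ P n a M := by
  cases n <;> exact Iff.rfl

theorem liftRel_tickL {A : Obj} {P : ∀ n, A.T n → Tm 0 → Prop} {n : ℕ}
    {y : (later (lift A)).T n} {M M' : Tm 0} (h : Reduces 1 M M')
    (hy : LaterRel (LiftRel P) n y M') : LiftRel P n ((Hom.tickL A).app n y) M := by
  cases n with
  | zero => exact ⟨M', h⟩
  | succ n => exact ⟨M', h, hy⟩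

theorem LiftRel.mono {A : Obj} {P : ∀ n, A.T n → Tm 0 → Prop} {n : ℕ}
    (hP : ∀ j, j ≤ n → ∀ a M, P (j + 1) a M → P j (A.r j a) M) {x : (lift A).T (n + 1)} {M : Tm 0}
    (h : LiftRel P (n + 1) x M) : LiftRel P n ((lift A).r n x) M := by
  induction n generalizing M with
  | zero =>
    obtain a | y := x
    · exact hP 0 le_rfl a M h
    · obtain ⟨M', h, -⟩ := h
      exact ⟨M', h⟩
  | succ n ih =>
    obtain a | y := x
    · exact hP _ le_rfl a M h
    · obtain ⟨M', h, hy⟩ := h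
      exact ⟨M', h, ih (fun j hj => hP j (hj.trans (Nat.le_succ n))) hy⟩

theorem LaterRel.mono {X : Obj} {P : ∀ n, X.T n → Tm 0 → Prop} {n : ℕ}
    (hP : ∀ j, j < n → ∀ a M, P (j + 1) a M → P j (X.r j a) M) {x : (later X).T (n + 1)} {M : Tm 0}
    (h : LaterRel P (n + 1) x M) : LaterRel P n ((later X).r n x) M := by
  cases n with
  | zero => trivial
  | succ n => exact hP n n.lt_succ_self x M h

theorem laterRel_next {X : Obj} {P : ∀ n, X.T n → Tm 0 → Prop}
    (hP : ∀ n a M, P (n + 1) a M → P n (X.r n a) M) {n : ℕ} {x : X.T n} {M : Tm 0}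
    (h : P n x M) : LaterRel P n ((Hom.next X).app n x) M := by
  cases n with
  | zero => trivial
  | succ n => exact hP n x M h

theorem LiftRel.expand {A : Obj} {P : ∀ n, A.T n → Tm 0 → Prop} {n : ℕ} {M M' : Tm 0}
    (h : Reduces 0 M M') (hP : ∀ a, P n a M' → P n a M) {x : (lift A).T n}
    (hx : LiftRel P n x M') : LiftRel P n x M := by
  cases n with
  | zero =>
    obtain a | y := x
    · exact hP a hx
    · obtain ⟨M'', h'⟩ := hx
      exact ⟨M'', h.trans h'⟩
  | succ n =>
    obtain a | y := x
    · exact hP a hx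
    · obtain ⟨M'', h', hy⟩ := hx
      exact ⟨M'', h.trans h', hy⟩

theorem SumRel.expand {X Y : Obj} {P : ∀ n, X.T n → Tm 0 → Prop} {Q : ∀ n, Y.T n → Tm 0 → Prop}
    {n : ℕ} {M M' : Tm 0} (h : Reduces 0 M M') (x : (Obj.sum X Y).T n)
    (hx : SumRel P Q n x M') : SumRel P Q n x M := by
  obtain x | y := x
  · obtain ⟨L, h', hL⟩ := hx
    exact ⟨L, h.trans h', hL⟩
  · obtain ⟨L, h', hL⟩ := hx
    exact ⟨L, h.trans h', hL⟩

theorem SumRel.mono {X Y : Obj} {P : ∀ n, X.T n → Tm 0 → Prop} {Q : ∀ n, Y.T n → Tm 0 → Prop}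
    {n : ℕ} (hP : ∀ a M, P (n + 1) a M → P n (X.r n a) M)
    (hQ : ∀ a M, Q (n + 1) a M → Q n (Y.r n a) M) {x : (Obj.sum X Y).T (n + 1)} {M : Tm 0}
    (hx : SumRel P Q (n + 1) x M) : SumRel P Q n ((Obj.sum X Y).r n x) M := by
  obtain x | y := x
  · obtain ⟨L, h, hL⟩ := hx
    exact ⟨L, h, hP _ _ hL⟩
  · obtain ⟨L, h, hL⟩ := hx
    exact ⟨L, h, hQ _ _ hL⟩

/-- The logical relation is closed under expansion by reductions that take no steps. -/
theorem Rel.expand : ∀ {σ : Ty 0} {n : ℕ} {x : (den₀ σ).T n} {M M' : Tm 0}, Reduces 0 M M' →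
    Rel σ n x M' → Rel σ n x M
  | .unit, n, x, M, M', h, hx => by
    rw [rel_unit] at hx ⊢
    exact hx.expand h fun _ => h.trans
  | .prod σ τ, n, x, M, M', h, hx => by
    rw [rel_prod] at hx ⊢
    exact ⟨Rel.expand h.fst hx.1, Rel.expand h.snd hx.2⟩
  | .sum σ τ, n, x, M, M', h, hx => by
    rw [rel_sum] at hx ⊢
    exact hx.expand h fun _ => SumRel.expand h _
  | .arrow σ τ, n, x, M, M', h, hx => by
    rw [rel_arrow] at hx ⊢
    exact fun j hj y N hy => Rel.expand (h.app N) (hx j hj y N hy)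
  | .mu τ, n, x, M, M', h, hx => by
    rw [rel_mu] at hx ⊢
    obtain ⟨M'', h', hx⟩ := hx
    exact ⟨M'', h.unfold.trans h', hx⟩

/-- Inner half of a lexicographic induction: structural on types, with `ih` covering earlier stages
for recursive types. All `j ≤ n` are treated at once because relations at sums look at their
components at every earlier stage. -/
theorem rel_mono_step (n : ℕ) (ih : ∀ j, j < n → ∀ (σ : Ty 0) (x : (den₀ σ).T (j + 1)) (M : Tm 0),
    Rel σ (j + 1) x M → Rel σ j ((den₀ σ).r j x) M) :
    ∀ (σ : Ty 0) (j : ℕ) (_ : j ≤ n) (x : (den₀ σ).T (j + 1)) (M : Tm 0),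
      Rel σ (j + 1) x M → Rel σ j ((den₀ σ).r j x) M
  | .unit, j, hj, x, M, hx => by
    rw [rel_unit] at hx ⊢
    exact hx.mono fun _ _ _ _ h => h
  | .prod σ τ, j, hj, x, M, hx => by
    rw [rel_prod] at hx ⊢
    exact ⟨rel_mono_step n ih σ j hj _ _ hx.1, rel_mono_step n ih τ j hj _ _ hx.2⟩
  | .sum σ τ, j, hj, x, M, hx => by
    rw [rel_sum] at hx ⊢
    exact hx.mono fun i hi _ _ => SumRel.mono (rel_mono_step n ih σ i (hi.trans hj))
      (rel_mono_step n ih τ i (hi.trans hj))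
  | .arrow σ τ, j, hj, x, M, hx => by
    rw [rel_arrow] at hx ⊢
    -- Restriction is built into the arrow clause, which quantifies over all earlier stages.
    exact fun i hi => hx i (Nat.le_succ_of_le hi)
  | .mu τ, j, hj, x, M, hx => by
    rw [rel_mu] at hx ⊢
    obtain ⟨M', h, hx⟩ := hx
    refine ⟨M', h, ?_⟩
    rw [← (muUnfold τ).nat]
    exact hx.mono fun i hi => ih i (hi.trans_le hj) _

/-- The logical relation is closed under restriction. -/
theorem Rel.mono {σ : Ty 0} {n : ℕ} {x : (den₀ σ).T (n + 1)} {M : Tm 0}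
    (h : Rel σ (n + 1) x M) : Rel σ n ((den₀ σ).r n x) M := by
  have key : ∀ n, ∀ j, j < n → ∀ (σ : Ty 0) (x : (den₀ σ).T (j + 1)) (M : Tm 0),
      Rel σ (j + 1) x M → Rel σ j ((den₀ σ).r j x) M := by
    intro n
    induction n with
    | zero => exact fun j hj => absurd hj j.not_lt_zero
    | succ n ih => exact fun j hj σ => rel_mono_step n ih σ j (Nat.le_of_lt_succ hj)
  exact key (n + 1) n n.lt_succ_self σ x M h

theorem LaterRel.res {σ : Ty 0} {j n : ℕ} (h : j ≤ n) {x : (later (den₀ σ)).T n} {M : Tm 0}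
    (hx : LaterRel (Rel σ) n x M) : LaterRel (Rel σ) j ((later (den₀ σ)).res h x) M := by
  induction h using Nat.decreasingInduction with
  | self => rwa [res_self]
  | of_succ k hk ih =>
    rw [← res_r _ hk]
    exact ih.mono fun _ _ _ _ => Rel.mono

/-- Again induction on the type inside induction on the stage. At products and functions, `θ` is
computed under an elimination, and the step of `M` persists in that evaluation context. -/
theorem rel_tick_step (n : ℕ) (ih : ∀ j, j < n → ∀ (σ : Ty 0) (x : (later (den₀ σ)).T j)
      (M M' : Tm 0), Reduces 1 M M' → LaterRel (Rel σ) j x M' → Rel σ j ((tick σ).app j x) M) :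
    ∀ (σ : Ty 0) (j : ℕ) (_ : j ≤ n) (x : (later (den₀ σ)).T j) (M M' : Tm 0), Reduces 1 M M' →
      LaterRel (Rel σ) j x M' → Rel σ j ((tick σ).app j x) M
  | .unit, j, hj, x, M, M', h, hx => by
    rw [rel_unit] at hx ⊢
    rw [tick_unit]
    exact liftRel_tickL h hx
  | .prod σ τ, j, hj, x, M, M', h, hx => by
    rw [rel_prod, tick_prod]
    refine ⟨rel_tick_step n ih σ j hj _ _ _ h.fst ?_, rel_tick_step n ih τ j hj _ _ _ h.snd ?_⟩
    · cases j with
      | zero => trivial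
      | succ j => exact ((rel_prod σ τ j x M').1 hx).1
    · cases j with
      | zero => trivial
      | succ j => exact ((rel_prod σ τ j x M').1 hx).2
  | .sum σ τ, j, hj, x, M, M', h, hx => by
    rw [rel_sum] at hx ⊢
    rw [tick_sum]
    exact liftRel_tickL h hx
  | .arrow σ τ, j, hj, x, M, M', h, hx => by
    rw [rel_arrow]
    intro i hi y N hy
    rw [tick_arrow]
    refine rel_tick_step n ih τ i (hi.trans hj) _ _ _ (h.app N) ?_
    have hx' := hx.res hi
    generalize (later (den₀ (.arrow σ τ))).res hi x = f at hx'
    cases i with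
    | zero => trivial
    -- Delayed application acts one stage earlier, on the argument restricted by `next`; hence the
    -- use of monotonicity for `hy`.
    | succ i => exact (rel_arrow σ τ i f M').1 hx' i le_rfl _ N hy.mono
  | .mu τ, j, hj, x, M, M', h, hx => by
    rw [rel_mu]
    refine ⟨_, h.unfold, ?_⟩
    cases j with
    | zero => trivial
    | succ j =>
      -- Two steps occur. The one from `unfold M` to `unfold M'` pays for the `μ` clause; the one
      -- from `unfold M'` to `M''` pays for the `θ` of the unfolded type, through the stage
      -- hypothesis.
      obtain ⟨M'', h', hx⟩ := (rel_mu τ j x M').1 hx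
      exact (congrArg (Rel _ j · _) (tick_mu τ j x)).mpr (ih j hj _ _ _ _ h' hx)

/-- The `▷`-algebra structures are related to steps of the operational semantics. -/
theorem rel_tick {σ : Ty 0} {n : ℕ} {x : (later (den₀ σ)).T n} {M M' : Tm 0}
    (h : Reduces 1 M M') (hx : LaterRel (Rel σ) n x M') : Rel σ n ((tick σ).app n x) M := by
  have key : ∀ n, ∀ j, j < n → ∀ (σ : Ty 0) (x : (later (den₀ σ)).T j) (M M' : Tm 0),
      Reduces 1 M M' → LaterRel (Rel σ) j x M' → Rel σ j ((tick σ).app j x) M := by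
    intro n
    induction n with
    | zero => exact fun j hj => absurd hj j.not_lt_zero
    | succ n ih => exact fun j hj σ => rel_tick_step n ih σ j (Nat.le_of_lt_succ hj)
  exact key (n + 1) n n.lt_succ_self σ x M M' h hx

/-- Each `θ` layer of the scrutinee is a step of `L`, hence of the whole `case`, and the extension
turns it into a `θ` of the result type. Peeling a layer lowers the stage, so the invariant `E` on
parameters must survive restriction. -/
theorem rel_extend {C A : Obj} {τ : Ty 0} {f : Hom (Obj.prod C A) (den₀ τ)}
    {P : ∀ n, A.T n → Tm 0 → Prop} {E : ∀ n, C.T n → Prop} {M N : Tm 1}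
    (hE : ∀ n c, E (n + 1) c → E n (C.r n c))
    (hf : ∀ n c a L, E n c → P n a L → Rel τ n (f.app n (c, a)) (.case L M N)) {n : ℕ} {c : C.T n}
    {x : (lift A).T n} {L : Tm 0} (hc : E n c) (hx : LiftRel P n x L) :
    Rel τ n ((Hom.extend (tick τ) f).app n (c, x)) (.case L M N) := by
  induction n generalizing L with
  | zero =>
    obtain a | y := x
    · exact hf 0 c a L hc hx
    · obtain ⟨L', h⟩ := hx
      exact rel_tick (h.case M N) trivial
  | succ n ih =>
    obtain a | y := x
    · exact hf _ c a L hc hx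
    · obtain ⟨L', h, hy⟩ := hx
      exact rel_tick (h.case M N) (ih (hE n c hc) hy)

/-! ### The fundamental theorem of the logical relation -/

/-- The logical relation between environments and closing substitutions. -/
def EnvRel {m : ℕ} (Γ : Ctx m) (s : Fin m → Tm 0) (n : ℕ) (γ : Γ.den.T n) : Prop :=
  ∀ i, Rel (Γ i) n (γ i) (s i)

theorem EnvRel.mono {m : ℕ} {Γ : Ctx m} {s : Fin m → Tm 0} {n : ℕ} {γ : Γ.den.T (n + 1)}
    (h : EnvRel Γ s (n + 1) γ) : EnvRel Γ s n (Γ.den.r n γ) := fun i => (h i).mono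

theorem EnvRel.res {m : ℕ} {Γ : Ctx m} {s : Fin m → Tm 0} {j n : ℕ} (h : j ≤ n) {γ : Γ.den.T n}
    (hγ : EnvRel Γ s n γ) : EnvRel Γ s j (Γ.den.res h γ) := by
  induction h using Nat.decreasingInduction with
  | self => rwa [res_self]
  | of_succ k hk ih =>
    rw [← res_r _ hk]
    exact ih.mono

theorem EnvRel.push {m : ℕ} {Γ : Ctx m} {s : Fin m → Tm 0} {n : ℕ} {γ : Γ.den.T n} {σ : Ty 0}
    {x : (den₀ σ).T n} {N : Tm 0} (h : EnvRel Γ s n γ) (hx : Rel σ n x N) :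
    EnvRel (Γ.snoc σ) (Fin.cons N s) n ((Γ.push σ).app n (γ, x)) := by
  intro i
  refine Fin.cases ?_ (fun i => ?_) i
  · exact hx
  · exact h i

/-- Fundamental theorem, by induction on the derivation. The stage and environment stay general
because `lam` and `case` use the hypotheses at earlier stages. -/
theorem Typing.rel {m : ℕ} {Γ : Ctx m} {M : Tm m} {τ : Ty 0} (d : Typing Γ M τ) :
    ∀ {n : ℕ} {γ : Γ.den.T n} {s : Fin m → Tm 0}, EnvRel Γ s n γ →
      Rel τ n (d.den.app n γ) (M.subst s) := by
  induction d with
  | var i => exact fun h => h i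
  | unit =>
    intro n γ s h
    rw [rel_unit]
    exact (liftRel_now _ _ _ _).2 (Reduces.refl _)
  | lam d ih =>
    intro n γ s h
    rw [rel_arrow]
    intro j hj y N hy
    refine Rel.expand (Reduces.app_lam _ _ _) ?_
    rw [subst_up_inst]
    exact ih ((h.res hj).push hy)
  | app d e ihd ihe =>
    intro n γ s h
    exact (rel_arrow _ _ _ _ _).1 (ihd h) n le_rfl _ _ (ihe h)
  | inl d ih =>
    intro n γ s h
    rw [rel_sum]
    exact (liftRel_now _ _ _ _).2 ⟨_, Reduces.refl _, ih h⟩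
  | inr d ih =>
    intro n γ s h
    rw [rel_sum]
    exact (liftRel_now _ _ _ _).2 ⟨_, Reduces.refl _, ih h⟩
  | @case _ Γ σ₁ σ₂ τ L M N c d e ihc ihd ihe =>
    intro n γ s h
    have hc := ihc h
    rw [rel_sum] at hc
    refine rel_extend (E := EnvRel Γ s) (fun _ _ => EnvRel.mono) ?_ h hc
    -- The scrutinee now behaves like an injection at no cost, so the `case` reduces in zero steps
    -- to the chosen branch.
    rintro j γ' (x | x) L' hγ ⟨L'', hL, hx⟩
    · refine Rel.expand ((hL.case _ _).trans (Reduces.case_inl _ _ _)) ?_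
      rw [subst_up_inst]
      exact ihd (hγ.push hx)
    · refine Rel.expand ((hL.case _ _).trans (Reduces.case_inr _ _ _)) ?_
      rw [subst_up_inst]
      exact ihe (hγ.push hx)
  | pair d e ihd ihe =>
    intro n γ s h
    rw [rel_prod]
    exact ⟨(ihd h).expand (Reduces.fst_pair _ _), (ihe h).expand (Reduces.snd_pair _ _)⟩
  | fst d ih =>
    intro n γ s h
    exact ((rel_prod _ _ _ _ _).1 (ih h)).1
  | snd d ih =>
    intro n γ s h
    exact ((rel_prod _ _ _ _ _).1 (ih h)).2
  | unfold d ih =>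
    intro n γ s h
    -- The `μ` clause supplies exactly the two hypotheses of `rel_tick`.
    obtain ⟨M', h', hx⟩ := (rel_mu _ _ _ _).1 (ih h)
    exact rel_tick h' hx
  | @fold _ _ τ _ d ih =>
    intro n γ s h
    rw [rel_mu]
    refine ⟨_, Reduces.unfold_fold _, ?_⟩
    have e : (muUnfold τ).app n ((Typing.fold d).den.app n γ) =
      (Hom.next _).app n (d.den.app n γ) := ofEq_ofEq_symm (den_mu τ Fin.elim0) n _
    rw [e]
    exact laterRel_next (fun _ _ _ => Rel.mono) (ih h)

theorem Typing.rel_denGlob {M : Tm 0} {τ : Ty 0} (d : Typing Ctx.nil M τ) (n : ℕ) :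
    Rel τ n (d.denGlob.val n) M := by
  have h := d.rel (n := n) (γ := fun i => i.elim0) (s := Tm.var) fun i => i.elim0
  rwa [subst_var] at h

/-! ### Execution -/

theorem Glob.distrib_of_inl {X Y : Obj} {x : Glob (Obj.sum X Y)} {a : X.T 0}
    (h : x.val 0 = Sum.inl a) : ∃ y, x.distrib = .inl y := by
  have h' : (x.val 0).isLeft = true := by rw [h, Sum.isLeft_inl]
  exact ⟨_, dif_pos h'⟩

theorem Glob.distrib_of_inr {X Y : Obj} {x : Glob (Obj.sum X Y)} {b : Y.T 0}
    (h : x.val 0 = Sum.inr b) : ∃ y, x.distrib = .inr y := by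
  have h' : ¬ (x.val 0).isLeft = true := by rw [h, Sum.isLeft_inr]; exact Bool.false_ne_true
  exact ⟨_, dif_neg h'⟩

theorem Glob.val_of_distrib_inl {X Y : Obj} {x : Glob (Obj.sum X Y)} {y : Glob X}
    (h : x.distrib = .inl y) (n : ℕ) : x.val n = Sum.inl (y.val n) := by
  unfold Glob.distrib at h
  split at h
  · obtain rfl := Sum.inl.inj h
    exact (Sum.inl_getLeft _ _).symm
  · cases h

theorem Glob.val_of_distrib_inr {X Y : Obj} {x : Glob (Obj.sum X Y)} {y : Glob Y}
    (h : x.distrib = .inr y) (n : ℕ) : x.val n = Sum.inr (y.val n) := by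
  unfold Glob.distrib at h
  split at h
  · cases h
  · obtain rfl := Sum.inr.inj h
    exact (Sum.inr_getRight _ _).symm

/-- A global element of a sum stays in the summand where it starts, so stage `0` decides the
outcome. -/
theorem runstep_of_inl {x : BoolGlob} {b : (Obj.sum (lift one) (lift one)).T 0}
    (h : x.val 0 = Sum.inl b) : runstep x = .inl (Sum.map (fun _ => ()) (fun _ => ()) b) := by
  obtain ⟨y, hy⟩ := Glob.distrib_of_inl (x := x.map (Hom.liftUnfold _)) h
  have hb : y.val 0 = b := Sum.inl.inj ((Glob.val_of_distrib_inl hy 0).symm.trans h)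
  unfold runstep
  rw [hy]
  obtain a | a := b
  · obtain ⟨z, hz⟩ := Glob.distrib_of_inl hb
    simp only [hz]
    rfl
  · obtain ⟨z, hz⟩ := Glob.distrib_of_inr hb
    simp only [hz]
    rfl

/-- `force` shifts indices: stage `n + 1` of `x` carries stage `n` of the remaining computation. -/
theorem runstep_of_inr {x : BoolGlob} {b : PUnit} (h : x.val 0 = Sum.inr b) :
    ∃ y : BoolGlob, runstep x = .inr y ∧ ∀ n, x.val (n + 1) = Sum.inr (y.val n) := by
  obtain ⟨z, hz⟩ := Glob.distrib_of_inr (x := x.map (Hom.liftUnfold _)) h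
  have e (n : ℕ) : x.val (n + 1) = Sum.inr (z.force.val n) := by
    refine Eq.trans ?_ (Glob.val_of_distrib_inr hz (n + 1))
    rfl
  refine ⟨z.force, ?_, e⟩
  unfold runstep
  rw [hz]

/-- The relation is assumed at all stages because each stripped `θ` uses one up. Being stated for
all related pairs, the claim passes to the remaining computation and the reduct. -/
theorem exec_eq_inl_iff (n : ℕ) : ∀ (x : BoolGlob) (M : Tm 0),
    (∀ i, Rel Ty.bool i (x.val i) M) →
      (exec n x = Sum.inl (Sum.inl ()) ↔ ∃ N k, k ≤ n ∧ BigStep M k (.inl N)) := by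
  have value : ∀ (n : ℕ) (x : BoolGlob) (M : Tm 0) b, x.val 0 = Sum.inl b →
      Rel Ty.bool 0 (x.val 0) M →
      (runstep x = Sum.inl (Sum.inl ()) ↔ ∃ N k, k ≤ n ∧ BigStep M k (.inl N)) := by
    intro n x M b hb hx
    rw [runstep_of_inl hb]
    rw [rel_sum, hb] at hx
    obtain a | a := b
    · obtain ⟨L, hL, -⟩ := hx
      exact iff_of_true rfl ⟨L, 0, n.zero_le, (hL _ _).2 ⟨0, rfl, .val (.inl L)⟩⟩
    · obtain ⟨L, hL, -⟩ := hx
      refine iff_of_false (by simp) ?_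
      rintro ⟨N, k, -, hk⟩
      -- `M` evaluates as a right injection does, which is a value and never evaluates to a left
      -- one.
      obtain ⟨k', -, ⟨⟩⟩ := (hL _ _).1 hk
  have step : ∀ (x : BoolGlob) (M : Tm 0) b, x.val 0 = Sum.inr b →
      (∀ i, Rel Ty.bool i (x.val i) M) → ∃ (y : BoolGlob) (M' : Tm 0), runstep x = .inr y ∧
        Reduces 1 M M' ∧ ∀ i, Rel Ty.bool i (y.val i) M' := by
    intro x M b hb hx
    obtain ⟨y, hy, hxy⟩ := runstep_of_inr hb
    have key : ∀ i, ∃ M', Reduces 1 M M' ∧ Rel Ty.bool i (y.val i) M' := by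
      intro i
      have hi := hx (i + 1)
      rw [rel_sum, hxy] at hi
      rw [rel_sum]
      exact hi
    -- The reduct obtained may depend on the stage. Fixing the one from stage `0`, confluence
    -- identifies it with the others up to zero-step expansion.
    obtain ⟨M', h, -⟩ := key 0
    refine ⟨y, M', hy, h, fun i => ?_⟩
    obtain ⟨M'', h', hi⟩ := key i
    exact hi.expand (h.confluent h')
  induction n with
  | zero =>
    intro x M hx
    rcases hb : x.val 0 with b | b
    · exact value 0 x M b hb (hx 0)
    · obtain ⟨y, M', hy, h, -⟩ := step x M b hb hx
      rw [exec, hy]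
      refine iff_of_false (by simp) ?_
      -- `exec 0` performs one `runstep`, which here only finds a `θ`; correspondingly every
      -- evaluation of `M` takes at least one step.
      rintro ⟨N, k, hk, e⟩
      obtain ⟨k', rfl, -⟩ := (h _ _).1 e
      exact absurd hk (Nat.not_succ_le_zero k')
  | succ n ih =>
    intro x M hx
    rcases hb : x.val 0 with b | b
    · have e : exec (n + 1) x = runstep x := by
        rw [exec, runstep_of_inl hb]
      rw [e]
      exact value _ x M b hb (hx 0)
    · obtain ⟨y, M', hy, h, hM'⟩ := step x M b hb hx
      have e : exec (n + 1) x = exec n y := by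
        rw [exec, hy]
      rw [e, ih y M' hM']
      constructor
      · rintro ⟨N, k, hk, e⟩
        exact ⟨N, k + 1, Nat.succ_le_succ hk, (h _ _).2 ⟨k, rfl, e⟩⟩
      · rintro ⟨N, k, hk, e⟩
        obtain ⟨k', rfl, e'⟩ := (h _ _).1 e
        exact ⟨N, k', Nat.le_of_succ_le_succ hk, e'⟩

end FPC

theorem mainTheorem5 (M : FPC.Tm 0) (d : FPC.Typing FPC.Ctx.nil M FPC.Ty.bool) (n : ℕ) :
    FPC.exec n d.denGlob = Sum.inl (Sum.inl ()) ↔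
      ∃ (N : FPC.Tm 0) (k : ℕ), k ≤ n ∧ FPC.Tm.BigStep M k (FPC.Tm.inl N) :=
  FPC.exec_eq_inl_iff n d.denGlob M d.rel_denGlob
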